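/- Let $N>0$, $N_0\ge 0$ and $0\le k\le 1$. For $z\in\mathbb C$ let $|z\rangle$ be the coherent state of one bosonic mode and $\tau_{N}=\frac1{N+1}\sum_{n\ge0}\left(\frac{N}{N+1}\right)^n|n\rangle\langle n|$ the thermal state of mean photon number $N$. The thermal channel mixes the signal mode $a$ with an ancilla mode $b$ in the state $\tau_{N_0}$ on a beamsplitter $U$ of transmittivity $k$, where $U^\dagger aU=ka+\sqrt{1-k^2}\,b$ and $U^\dagger bU=kb-\sqrt{1-k^2}\,a$. Put $\theta_z^{BE}=U(|z\rangle\langle z|\otimes\tau_{N_0})U^\dagger$, where $B$ is the output signal mode and $E$ the output ancilla mode, with marginals $\theta_z^B$ and $\theta_z^E$. Let $Z$ be a complex random variable with density $\psi_N(z)=(\pi N)^{-1}e^{-|z|^2/N}$. Let $P$ be a probability distribution on $m$ real points with mean $0$ and variance $1$, and let $Z_m=\sqrt{N/2}\,(X+iX')$ with $X,X'$ independent of law $P$. Write $\rho^B=\mathbb E[\theta^B_Z]$, $\rho_m^{B_m}=\mathbb E[\theta^B_{Z_m}]$, $I(Z:B)=H(\rho^B)-\mathbb E[H(\theta_Z^B)]$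 and $I(Z_m:B_m)=H(\rho_m^{B_m})-\mathbb E[H(\theta_{Z_m}^B)]$, and similarly for $E$. Here $H(\rho)=-\operatorname{Tr}[\rho\log\rho]$ and $D(\rho\|\sigma)=\operatorname{Tr}[\rho(\log\rho-\log\sigma)]$. Then all these entropies are finite, and $$I(Z:B)-I(Z_m:B_m)=D(\rho_m^{B_m}\|\rho^B),\qquad I(Z:E)-I(Z_m:E_m)=D(\rho_m^{E_m}\|\rho^E).$$ The statement for $B$ holds also for the additive Gaussian noise channel (the thermal channel with $k=1$ and noise parameter $N_c>0$), for which $\theta_z^B=\int_{\mathbb C}\psi_{N_c}(w)\,|z+w\rangle\langle z+w|\,dw$. -/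

import Mathlib

open MeasureTheory
open scoped ENNReal InnerProductSpace

noncomputable section

namespace ThermalChannel

/-! ### Number-basis model of the modes -/

/-- The Hilbert space `ℓ²(ι)`; its canonical basis is the number basis.  `Fock ℕ` is the space of
one bosonic mode, `Fock (ℕ × ℕ)` the space of two modes (signal first, ancilla second). -/
def Fock (ι : Type) : Type := lp (fun _ : ι => ℂ) 2

instance (ι : Type) : NormedAddCommGroup (Fock ι) :=
  inferInstanceAs (NormedAddCommGroup (lp (fun _ : ι => ℂ) 2))

instance (ι : Type) : InnerProductSpace ℂ (Fock ι) :=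
  inferInstanceAs (InnerProductSpace ℂ (lp (fun _ : ι => ℂ) 2))

instance (ι : Type) : CompleteSpace (Fock ι) :=
  inferInstanceAs (CompleteSpace (lp (fun _ : ι => ℂ) 2))

/-- Bounded operators on `ℓ²(ι)`. -/
abbrev Op (ι : Type) : Type := Fock ι →L[ℂ] Fock ι

/-- The number state `|i⟩`. -/
def ket {ι : Type} [DecidableEq ι] (i : ι) : Fock ι :=
  (lp.single 2 i (1 : ℂ) : lp (fun _ : ι => ℂ) 2)

/-- The rank one operator `|v⟩⟨v|`. -/
def proj {ι : Type} (v : Fock ι) : Op ι := InnerProductSpace.rankOne ℂ v v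

theorem inner_ket_ket {ι : Type} [DecidableEq ι] (i j : ι) :
    ⟪ket i, ket j⟫_ℂ = if i = j then 1 else 0 := by
  have h : ⟪ket i, ket j⟫_ℂ = ⟪(1 : ℂ), (lp.single 2 j (1 : ℂ) : lp (fun _ : ι => ℂ) 2) i⟫_ℂ :=
    lp.inner_single_left (𝕜 := ℂ) (G := fun _ : ι => ℂ) i (1 : ℂ) (lp.single 2 j (1 : ℂ) : lp (fun _ : ι => ℂ) 2)
  rw [h, lp.single_apply]
  by_cases hij : i = j
  · subst hij; simp
  · simp [hij]

theorem orthonormal_ket (ι : Type) [DecidableEq ι] :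
    Orthonormal ℂ (ket : ι → Fock ι) :=
  orthonormal_iff_ite.2 inner_ket_ket

/-- The isometry `ℓ²(ι) → ℓ²(κ)` with `|i⟩ ↦ v i`, for an orthonormal family `v`. -/
def isometryOf {ι κ : Type} {v : ι → Fock κ} (hv : Orthonormal ℂ v) : Fock ι →L[ℂ] Fock κ :=
  (hv.orthogonalFamily.linearIsometry : lp (fun _ : ι => ℂ) 2 →ₗᵢ[ℂ] Fock κ).toContinuousLinearMap

theorem isometryOf_ket {ι κ : Type} [DecidableEq ι] {v : ι → Fock κ} (hv : Orthonormal ℂ v)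
    (i : ι) : isometryOf hv (ket i) = v i := by
  have h := hv.orthogonalFamily.linearIsometry_apply_single (i := i) (1 : ℂ)
  refine Eq.trans h ?_
  simp

theorem coherent_memlp (z : ℂ) :
    Memℓp (fun n : ℕ => (Real.exp (-‖z‖ ^ 2 / 2) : ℂ) * (z ^ n / (Real.sqrt n.factorial : ℂ))) 2 := by
  refine memℓp_gen ?_
  have h := (Real.summable_pow_div_factorial (‖z‖ ^ 2)).mul_left (Real.exp (-‖z‖ ^ 2 / 2) ^ 2)
  refine h.congr fun n => ?_
  have hn : (0 : ℝ) ≤ n.factorial := by positivity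
  simp only [ENNReal.toReal_ofNat, Real.rpow_ofNat, norm_mul, norm_div, norm_pow,
    Complex.norm_real, Real.norm_eq_abs, mul_pow, div_pow, sq_abs, Real.sq_sqrt hn]
  ring

/-- The coherent state `|z⟩ = exp (-|z|²/2) ∑ₙ zⁿ / √(n!) |n⟩`. -/
def coherent (z : ℂ) : Fock ℕ :=
  (⟨fun n : ℕ => (Real.exp (-‖z‖ ^ 2 / 2) : ℂ) * (z ^ n / (Real.sqrt n.factorial : ℂ)),
    coherent_memlp z⟩ : lp (fun _ : ℕ => ℂ) 2)

/-! ### The beamsplitter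

On finite superpositions of number states the creation and annihilation operators are everywhere
defined linear maps. -/

/-- Finite superpositions of two-mode number states. -/
abbrev FinVec : Type := (ℕ × ℕ) →₀ ℂ

/-- The creation operator `a†` of the signal mode, `a†|m,n⟩ = √(m+1) |m+1,n⟩`. -/
def createA : FinVec →ₗ[ℂ] FinVec :=
  Finsupp.linearCombination ℂ fun p : ℕ × ℕ =>
    Finsupp.single (p.1 + 1, p.2) (Real.sqrt ((p.1 : ℝ) + 1) : ℂ)

/-- The creation operator `b†` of the ancilla mode, `b†|m,n⟩ = √(n+1) |m,n+1⟩`. -/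
def createB : FinVec →ₗ[ℂ] FinVec :=
  Finsupp.linearCombination ℂ fun p : ℕ × ℕ =>
    Finsupp.single (p.1, p.2 + 1) (Real.sqrt ((p.2 : ℝ) + 1) : ℂ)

/-- The annihilation operator `a` of the signal mode, `a|m,n⟩ = √m |m-1,n⟩`. -/
def annihA : FinVec →ₗ[ℂ] FinVec :=
  Finsupp.linearCombination ℂ fun p : ℕ × ℕ =>
    Finsupp.single (p.1 - 1, p.2) (Real.sqrt (p.1 : ℝ) : ℂ)

/-- The annihilation operator `b` of the ancilla mode, `b|m,n⟩ = √n |m,n-1⟩`. -/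
def annihB : FinVec →ₗ[ℂ] FinVec :=
  Finsupp.linearCombination ℂ fun p : ℕ × ℕ =>
    Finsupp.single (p.1, p.2 - 1) (Real.sqrt (p.2 : ℝ) : ℂ)

/-- The inclusion of the finite superpositions into the two-mode Hilbert space. -/
def toFock : FinVec →ₗ[ℂ] Fock (ℕ × ℕ) :=
  Finsupp.linearCombination ℂ ket

theorem createA_single (m n : ℕ) : createA (Finsupp.single (m, n) 1) =
    Finsupp.single (m + 1, n) (Real.sqrt ((m : ℝ) + 1) : ℂ) := by
  simp [createA]

theorem createB_single (m n : ℕ) : createB (Finsupp.single (m, n) 1) =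
    Finsupp.single (m, n + 1) (Real.sqrt ((n : ℝ) + 1) : ℂ) := by
  simp [createB]

theorem annihA_single (m n : ℕ) : annihA (Finsupp.single (m, n) 1) =
    Finsupp.single (m - 1, n) (Real.sqrt (m : ℝ) : ℂ) := by
  simp [annihA]

theorem annihB_single (m n : ℕ) : annihB (Finsupp.single (m, n) 1) =
    Finsupp.single (m, n - 1) (Real.sqrt (n : ℝ) : ℂ) := by
  simp [annihB]

theorem toFock_single (p : ℕ × ℕ) (c : ℂ) : toFock (Finsupp.single p c) = c • ket p := by
  simp [toFock]

theorem single_eq_smul (p : ℕ × ℕ) (c : ℂ) :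
    (Finsupp.single p c : FinVec) = c • Finsupp.single p 1 := by
  simp

/-- Equality of sesquilinear expressions may be checked on number states. -/
theorem adjoint_of_single {C A : FinVec →ₗ[ℂ] FinVec}
    (h : ∀ p q : ℕ × ℕ, ⟪toFock (C (Finsupp.single p 1)), toFock (Finsupp.single q 1)⟫_ℂ =
      ⟪toFock (Finsupp.single p 1), toFock (A (Finsupp.single q 1))⟫_ℂ) (f g : FinVec) :
    ⟪toFock (C f), toFock g⟫_ℂ = ⟪toFock f, toFock (A g)⟫_ℂ := by
  induction f using Finsupp.induction_linear with
  | zero => simp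
  | add f₁ f₂ h₁ h₂ => simp only [map_add, inner_add_left, h₁, h₂]
  | single p c =>
    induction g using Finsupp.induction_linear with
    | zero => simp
    | add g₁ g₂ h₁ h₂ => simp only [map_add, inner_add_right, h₁, h₂]
    | single q d =>
      rw [single_eq_smul p c, single_eq_smul q d]
      simp only [map_smul, inner_smul_left, inner_smul_right, h p q]

theorem adjoint_createA (f g : FinVec) :
    ⟪toFock (createA f), toFock g⟫_ℂ = ⟪toFock f, toFock (annihA g)⟫_ℂ := by
  refine adjoint_of_single (fun p q => ?_) f g
  obtain ⟨m, n⟩ := p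
  obtain ⟨m', n'⟩ := q
  rw [createA_single, annihA_single]
  simp only [toFock_single, inner_smul_left, inner_smul_right, inner_ket_ket, Prod.mk.injEq]
  rcases m' with _ | m'
  · simp
  · by_cases h : m = m'
    · subst h; simp
    · simp [h]

theorem adjoint_createB (f g : FinVec) :
    ⟪toFock (createB f), toFock g⟫_ℂ = ⟪toFock f, toFock (annihB g)⟫_ℂ := by
  refine adjoint_of_single (fun p q => ?_) f g
  obtain ⟨m, n⟩ := p
  obtain ⟨m', n'⟩ := q
  rw [createB_single, annihB_single]
  simp only [toFock_single, inner_smul_left, inner_smul_right, inner_ket_ket, Prod.mk.injEq]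
  rcases n' with _ | n'
  · simp
  · by_cases h : n = n'
    · subst h; simp
    · simp [h]

theorem ext_single {A B : FinVec →ₗ[ℂ] FinVec}
    (h : ∀ m n : ℕ, A (Finsupp.single (m, n) 1) = B (Finsupp.single (m, n) 1)) (f : FinVec) :
    A f = B f := by
  have : A = B := by
    refine Finsupp.lhom_ext' fun p => LinearMap.ext_ring ?_
    exact h p.1 p.2
  rw [this]

theorem sqrt_mul_sqrt_cast {x : ℝ} (hx : 0 ≤ x) :
    (Real.sqrt x : ℂ) * (Real.sqrt x : ℂ) = (x : ℂ) := by
  rw [← Complex.ofReal_mul, Real.mul_self_sqrt hx]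

theorem annihA_createA (f : FinVec) : annihA (createA f) = createA (annihA f) + f := by
  refine ext_single (A := annihA ∘ₗ createA) (B := createA ∘ₗ annihA + LinearMap.id)
    (fun m n => ?_) f
  simp only [LinearMap.comp_apply, LinearMap.add_apply, LinearMap.id_apply, createA_single,
    annihA_single]
  rw [single_eq_smul (m + 1, n), single_eq_smul (m - 1, n), map_smul, map_smul, createA_single,
    annihA_single]
  rcases m with _ | m
  · simp
  · simp only [Nat.add_sub_cancel, Finsupp.smul_single, smul_eq_mul, ← Finsupp.single_add]
    congr 1
    push_cast
    rw [sqrt_mul_sqrt_cast (by positivity), sqrt_mul_sqrt_cast (by positivity)]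
    push_cast
    ring

theorem annihB_createB (f : FinVec) : annihB (createB f) = createB (annihB f) + f := by
  refine ext_single (A := annihB ∘ₗ createB) (B := createB ∘ₗ annihB + LinearMap.id)
    (fun m n => ?_) f
  simp only [LinearMap.comp_apply, LinearMap.add_apply, LinearMap.id_apply, createB_single,
    annihB_single]
  rw [single_eq_smul (m, n + 1), single_eq_smul (m, n - 1), map_smul, map_smul, createB_single,
    annihB_single]
  rcases n with _ | n
  · simp
  · simp only [Nat.add_sub_cancel, Finsupp.smul_single, smul_eq_mul, ← Finsupp.single_add]
    congr 1
    push_cast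
    rw [sqrt_mul_sqrt_cast (by positivity), sqrt_mul_sqrt_cast (by positivity)]
    push_cast
    ring

theorem annihA_createB (f : FinVec) : annihA (createB f) = createB (annihA f) := by
  refine ext_single (A := annihA ∘ₗ createB) (B := createB ∘ₗ annihA) (fun m n => ?_) f
  simp only [LinearMap.comp_apply, createB_single, annihA_single]
  rw [single_eq_smul (m, n + 1), single_eq_smul (m - 1, n), map_smul, map_smul, createB_single,
    annihA_single]
  simp [mul_comm]

theorem annihB_createA (f : FinVec) : annihB (createA f) = createA (annihB f) := by
  refine ext_single (A := annihB ∘ₗ createA) (B := createA ∘ₗ annihB) (fun m n => ?_) f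
  simp only [LinearMap.comp_apply, createA_single, annihB_single]
  rw [single_eq_smul (m + 1, n), single_eq_smul (m, n - 1), map_smul, map_smul, createA_single,
    annihB_single]
  simp [mul_comm]

/-- `√(1-k²)`, the amplitude with which the beamsplitter couples the two modes. -/
def lossAmp (k : ℝ) : ℝ := Real.sqrt (1 - k ^ 2)

/-- The image `U a† U† = k a† - √(1-k²) b†` of the signal creation operator. -/
def splitA (k : ℝ) : FinVec →ₗ[ℂ] FinVec := (k : ℂ) • createA - (lossAmp k : ℂ) • createB

/-- The image `U b† U† = √(1-k²) a† + k b†` of the ancilla creation operator. -/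
def splitB (k : ℝ) : FinVec →ₗ[ℂ] FinVec := (lossAmp k : ℂ) • createA + (k : ℂ) • createB

/-- The adjoint of `splitA`. -/
def unsplitA (k : ℝ) : FinVec →ₗ[ℂ] FinVec := (k : ℂ) • annihA - (lossAmp k : ℂ) • annihB

/-- The adjoint of `splitB`. -/
def unsplitB (k : ℝ) : FinVec →ₗ[ℂ] FinVec := (lossAmp k : ℂ) • annihA + (k : ℂ) • annihB

/-- The (not normalized) vector `(k a† - √(1-k²) b†)^m (√(1-k²) a† + k b†)^n |0,0⟩`. -/
def splitVec (k : ℝ) (m n : ℕ) : FinVec :=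
  (splitA k ^ m) ((splitB k ^ n) (Finsupp.single (0, 0) 1))

/-- The image `(k a† - √(1-k²) b†)^m (√(1-k²) a† + k b†)^n |0,0⟩ / √(m! n!)` of the number state
`|m,n⟩` under the beamsplitter. -/
def splitKet (k : ℝ) (p : ℕ × ℕ) : Fock (ℕ × ℕ) :=
  ((Real.sqrt (p.1.factorial * p.2.factorial))⁻¹ : ℂ) • toFock (splitVec k p.1 p.2)

theorem lossAmp_sq {k : ℝ} (h0 : 0 ≤ k) (h1 : k ≤ 1) :
    (k : ℂ) * k + (lossAmp k : ℂ) * (lossAmp k : ℂ) = 1 := by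
  have h : (0 : ℝ) ≤ 1 - k ^ 2 := by nlinarith
  rw [lossAmp, sqrt_mul_sqrt_cast h]
  push_cast
  ring

theorem adjoint_splitA (k : ℝ) (f g : FinVec) :
    ⟪toFock (splitA k f), toFock g⟫_ℂ = ⟪toFock f, toFock (unsplitA k g)⟫_ℂ := by
  simp only [splitA, unsplitA, LinearMap.sub_apply, LinearMap.smul_apply, map_sub, map_smul,
    inner_sub_left, inner_sub_right, inner_smul_left, inner_smul_right, adjoint_createA,
    adjoint_createB, Complex.conj_ofReal]

theorem adjoint_splitB (k : ℝ) (f g : FinVec) :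
    ⟪toFock (splitB k f), toFock g⟫_ℂ = ⟪toFock f, toFock (unsplitB k g)⟫_ℂ := by
  simp only [splitB, unsplitB, LinearMap.add_apply, LinearMap.smul_apply, map_add, map_smul,
    inner_add_left, inner_add_right, inner_smul_left, inner_smul_right, adjoint_createA,
    adjoint_createB, Complex.conj_ofReal]

theorem unsplitA_splitA {k : ℝ} (h0 : 0 ≤ k) (h1 : k ≤ 1) (f : FinVec) :
    unsplitA k (splitA k f) = splitA k (unsplitA k f) + f := by
  simp only [splitA, unsplitA, LinearMap.sub_apply, LinearMap.smul_apply, map_sub, map_smul,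
    annihA_createA, annihB_createB, annihA_createB, annihB_createA]
  have h := congrArg (fun c : ℂ => c • f) (lossAmp_sq h0 h1)
  simp only [one_smul] at h
  refine Eq.trans ?_ (congrArg (fun g : FinVec => _ + g) h)
  module

theorem unsplitB_splitB {k : ℝ} (h0 : 0 ≤ k) (h1 : k ≤ 1) (f : FinVec) :
    unsplitB k (splitB k f) = splitB k (unsplitB k f) + f := by
  simp only [splitB, unsplitB, LinearMap.add_apply, LinearMap.smul_apply, map_add, map_smul,
    annihA_createA, annihB_createB, annihA_createB, annihB_createA]
  have h := congrArg (fun c : ℂ => c • f) (lossAmp_sq h0 h1)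
  simp only [one_smul] at h
  refine Eq.trans ?_ (congrArg (fun g : FinVec => _ + g) h)
  module

theorem unsplitA_splitB (k : ℝ) (f : FinVec) :
    unsplitA k (splitB k f) = splitB k (unsplitA k f) := by
  simp only [splitB, unsplitA, LinearMap.add_apply, LinearMap.sub_apply, LinearMap.smul_apply,
    map_add, map_sub, map_smul, annihA_createA, annihB_createB, annihA_createB, annihB_createA]
  module

theorem unsplitB_splitA (k : ℝ) (f : FinVec) :
    unsplitB k (splitA k f) = splitA k (unsplitB k f) := by
  simp only [splitA, unsplitB, LinearMap.add_apply, LinearMap.sub_apply, LinearMap.smul_apply,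
    map_add, map_sub, map_smul, annihA_createA, annihB_createB, annihA_createB, annihB_createA]
  module

theorem unsplitA_vacuum (k : ℝ) : unsplitA k (Finsupp.single (0, 0) 1) = 0 := by
  simp [unsplitA, annihA_single, annihB_single]

theorem unsplitB_vacuum (k : ℝ) : unsplitB k (Finsupp.single (0, 0) 1) = 0 := by
  simp [unsplitB, annihA_single, annihB_single]

theorem splitVec_succ_left (k : ℝ) (m n : ℕ) :
    splitVec k (m + 1) n = splitA k (splitVec k m n) := by
  simp only [splitVec, pow_succ', Module.End.mul_apply]

theorem splitVec_zero_succ (k : ℝ) (n : ℕ) :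
    splitVec k 0 (n + 1) = splitB k (splitVec k 0 n) := by
  simp only [splitVec, pow_succ', Module.End.mul_apply, pow_zero, Module.End.one_apply]

theorem unsplitA_splitVec_zero (k : ℝ) (n : ℕ) : unsplitA k (splitVec k 0 n) = 0 := by
  induction n with
  | zero => simpa [splitVec] using unsplitA_vacuum k
  | succ n ih => rw [splitVec_zero_succ, unsplitA_splitB, ih, map_zero]

theorem unsplitA_splitVec {k : ℝ} (h0 : 0 ≤ k) (h1 : k ≤ 1) (m n : ℕ) :
    unsplitA k (splitVec k (m + 1) n) = ((m + 1 : ℕ) : ℂ) • splitVec k m n := by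
  induction m with
  | zero =>
    rw [splitVec_succ_left, unsplitA_splitA h0 h1, unsplitA_splitVec_zero]
    simp
  | succ m ih =>
    rw [splitVec_succ_left, unsplitA_splitA h0 h1, ih, map_smul, ← splitVec_succ_left]
    push_cast
    module

theorem unsplitB_splitVec {k : ℝ} (h0 : 0 ≤ k) (h1 : k ≤ 1) (n : ℕ) :
    unsplitB k (splitVec k 0 (n + 1)) = ((n + 1 : ℕ) : ℂ) • splitVec k 0 n := by
  induction n with
  | zero =>
    rw [splitVec_zero_succ, unsplitB_splitB h0 h1]
    simp [splitVec, unsplitB_vacuum]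
  | succ n ih =>
    rw [splitVec_zero_succ, unsplitB_splitB h0 h1, ih, map_smul, ← splitVec_zero_succ]
    push_cast
    module

theorem inner_splitVec {k : ℝ} (h0 : 0 ≤ k) (h1 : k ≤ 1) (m n m' n' : ℕ) :
    ⟪toFock (splitVec k m n), toFock (splitVec k m' n')⟫_ℂ =
      if m = m' ∧ n = n' then ((m.factorial * n.factorial : ℕ) : ℂ) else 0 := by
  induction m generalizing m' with
  | succ m ih =>
    rw [splitVec_succ_left, adjoint_splitA]
    rcases m' with _ | m'
    · simp [unsplitA_splitVec_zero]
    · rw [unsplitA_splitVec h0 h1, map_smul, inner_smul_right, ih]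
      by_cases h : m = m' ∧ n = n'
      · obtain ⟨rfl, rfl⟩ := h
        simp [Nat.factorial_succ, mul_assoc]
      · have h' : ¬ (m + 1 = m' + 1 ∧ n = n') := by simpa using h
        rw [if_neg h, if_neg h', mul_zero]
  | zero =>
    rcases m' with _ | m'
    · induction n generalizing n' with
      | succ n ih =>
        rw [splitVec_zero_succ, adjoint_splitB]
        rcases n' with _ | n'
        · simp [splitVec, unsplitB_vacuum]
        · rw [unsplitB_splitVec h0 h1, map_smul, inner_smul_right, ih]
          by_cases h : n = n'
          · subst h
            simp [Nat.factorial_succ]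
          · simp [h]
      | zero =>
        rcases n' with _ | n'
        · simp only [splitVec, pow_zero, Module.End.one_apply, toFock_single, one_smul,
            inner_ket_ket]
          simp
        · rw [splitVec_zero_succ, ← inner_conj_symm, adjoint_splitB]
          simp [splitVec, unsplitB_vacuum]
    · rw [splitVec_succ_left, ← inner_conj_symm, adjoint_splitA, unsplitA_splitVec_zero]
      simp

theorem orthonormal_splitKet {k : ℝ} (h0 : 0 ≤ k) (h1 : k ≤ 1) :
    Orthonormal ℂ (splitKet k) := by
  refine orthonormal_iff_ite.2 fun p q => ?_
  obtain ⟨m, n⟩ := p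
  obtain ⟨m', n'⟩ := q
  simp only [splitKet, inner_smul_left, inner_smul_right, inner_splitVec h0 h1, Prod.mk.injEq]
  by_cases h : m = m' ∧ n = n'
  · obtain ⟨rfl, rfl⟩ := h
    have hpos : (0 : ℝ) < (m.factorial : ℝ) * n.factorial := by positivity
    have hne : ((m.factorial : ℂ) * n.factorial) ≠ 0 := by exact_mod_cast hpos.ne'
    have hs := sqrt_mul_sqrt_cast hpos.le
    push_cast at hs
    simp only [and_self, if_true, map_inv₀, Complex.conj_ofReal]
    rw [← mul_assoc, ← mul_inv, hs]
    push_cast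
    exact inv_mul_cancel₀ hne
  · simp [h]

/-- The beamsplitter `U` of transmittivity `k ∈ [0, 1]`: the isometry of the two-mode space with
`U|m,n⟩ = (k a† - √(1-k²) b†)^m (√(1-k²) a† + k b†)^n |0,0⟩ / √(m! n!)`.  In the Heisenberg picture
`U† a U = k a + √(1-k²) b` and `U† b U = k b - √(1-k²) a`. -/
def beamsplitter (k : Set.Icc (0 : ℝ) 1) : Op (ℕ × ℕ) :=
  isometryOf (orthonormal_splitKet k.2.1 k.2.2)

/-! ### The thermal channel -/

theorem orthonormal_ket_left (n : ℕ) :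
    Orthonormal ℂ (fun m : ℕ => (ket (m, n) : Fock (ℕ × ℕ))) :=
  (orthonormal_ket (ℕ × ℕ)).comp (fun m : ℕ => (m, n)) fun _ _ h => congrArg Prod.fst h

theorem orthonormal_ket_right (m : ℕ) :
    Orthonormal ℂ (fun n : ℕ => (ket (m, n) : Fock (ℕ × ℕ))) :=
  (orthonormal_ket (ℕ × ℕ)).comp (fun n : ℕ => (m, n)) fun _ _ h => congrArg Prod.snd h

/-- The isometry `v ↦ v ⊗ |n⟩`. -/
def tensorKetRight (n : ℕ) : Fock ℕ →L[ℂ] Fock (ℕ × ℕ) := isometryOf (orthonormal_ket_left n)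

/-- The isometry `w ↦ |m⟩ ⊗ w`. -/
def tensorKetLeft (m : ℕ) : Fock ℕ →L[ℂ] Fock (ℕ × ℕ) := isometryOf (orthonormal_ket_right m)

/-- The photon number distribution `(N + 1)⁻¹ (N / (N + 1))ⁿ` of the thermal state `τ_N`. -/
def thermalProb (N : ℝ) (n : ℕ) : ℝ := 1 / (N + 1) * (N / (N + 1)) ^ n

/-- The product `ρ ⊗ τ_N` of a signal state with the thermal state `τ_N = ∑ₙ thermalProb N n |n⟩⟨n|`
of the ancilla mode. -/
def tensorThermal (N : ℝ) (ρ : Op ℕ) : Op (ℕ × ℕ) :=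
  ∑' n : ℕ, (thermalProb N n : ℂ) •
    (tensorKetRight n ∘L ρ ∘L ContinuousLinearMap.adjoint (tensorKetRight n))

/-- The joint state `U (ρ ⊗ τ_{N₀}) U†` of both output modes for the input `ρ`. -/
def jointOutput (k : Set.Icc (0 : ℝ) 1) (N₀ : ℝ) (ρ : Op ℕ) : Op (ℕ × ℕ) :=
  beamsplitter k ∘L tensorThermal N₀ ρ ∘L ContinuousLinearMap.adjoint (beamsplitter k)

/-- The partial trace over the second (ancilla) mode. -/
def traceAncilla (T : Op (ℕ × ℕ)) : Op ℕ :=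
  ∑' n : ℕ, ContinuousLinearMap.adjoint (tensorKetRight n) ∘L T ∘L tensorKetRight n

/-- The partial trace over the first (signal) mode. -/
def traceSignal (T : Op (ℕ × ℕ)) : Op ℕ :=
  ∑' m : ℕ, ContinuousLinearMap.adjoint (tensorKetLeft m) ∘L T ∘L tensorKetLeft m

/-- The state `θ_z^B` of the output signal mode when the coherent state `|z⟩` is sent through the
thermal channel. -/
def outputB (k : Set.Icc (0 : ℝ) 1) (N₀ : ℝ) (z : ℂ) : Op ℕ :=
  traceAncilla (jointOutput k N₀ (proj (coherent z)))

/-- The state `θ_z^E` of the output ancilla mode when the coherent state `|z⟩` is sent through the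
thermal channel. -/
def outputE (k : Set.Icc (0 : ℝ) 1) (N₀ : ℝ) (z : ℂ) : Op ℕ :=
  traceSignal (jointOutput k N₀ (proj (coherent z)))

/-- The circularly symmetric complex Gaussian density `ψ_N(z) = (π N)⁻¹ exp (-|z|²/N)`. -/
def gaussDensity (N : ℝ) (z : ℂ) : ℝ := (Real.pi * N)⁻¹ * Real.exp (-‖z‖ ^ 2 / N)

/-- The complex Gaussian law with density `ψ_N`. -/
def gaussLaw (N : ℝ) : Measure ℂ :=
  (volume : Measure ℂ).withDensity fun z => ENNReal.ofReal (gaussDensity N z)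

/-- The output for the coherent input `|z⟩` of the channel that adds classical Gaussian noise to the
field amplitude (the thermal channel for `k = 1` with noise parameter `N_c`): the amplitude is
displaced by a random `w` of density `ψ_{N_c}`, and a displacement by `w` turns `|z⟩` into
`|z + w⟩`, up to a phase. -/
def outputNoise (Nc : ℝ) (z : ℂ) : Op ℕ := ∫ w, proj (coherent (z + w)) ∂(gaussLaw Nc)

/-! ### Entropic quantities (natural logarithm) -/

/-- The trace of a positive operator. -/
def posTrace (T : Op ℕ) : ℝ≥0∞ := ∑' n : ℕ, ENNReal.ofReal (⟪ket n, T (ket n)⟫_ℂ).re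

/-- The von Neumann entropy `H(ρ) = -Tr[ρ log ρ]`. -/
def entropy (ρ : Op ℕ) : ℝ≥0∞ := posTrace (cfc Real.negMulLog ρ)

/-- The operator `(-log max(σ, ε))^{1/2}`, for a state `σ` and `0 < ε ≤ 1`. -/
def sqrtNegLog (ε : ℝ) (σ : Op ℕ) : Op ℕ :=
  cfc (fun x : ℝ => Real.sqrt (-Real.log (max x ε))) σ

/-- `-Tr[ρ log σ] ∈ [0, ∞]` for states `ρ` and `σ`: the supremum (monotone limit as `ε ↓ 0`) of
`Tr[ρ (-log max(σ, ε))]`, the trace being written as that of the positive operator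
`(-log max(σ, ε))^{1/2} ρ (-log max(σ, ε))^{1/2}`. -/
def crossEntropy (ρ σ : Op ℕ) : ℝ≥0∞ :=
  ⨆ ε ∈ Set.Ioc (0 : ℝ) 1, posTrace (sqrtNegLog ε σ * ρ * sqrtNegLog ε σ)

/-- The relative entropy `D(ρ‖σ) = Tr[ρ (log ρ - log σ)] ∈ [0, ∞]` of two states, for `ρ` of finite
entropy. -/
def relEntropy (ρ σ : Op ℕ) : EReal := (crossEntropy ρ σ : EReal) - (entropy ρ : EReal)

/-! ### Ensembles -/

/-- The average state `∫ θ_z dμ(z)` of the ensemble of the states `θ_z` with distribution `μ`. -/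
def averageState (μ : Measure ℂ) (θ : ℂ → Op ℕ) : Op ℕ := ∫ z, θ z ∂μ

/-- The mutual information `H(∫ θ_z dμ(z)) - ∫ H(θ_z) dμ(z)` of the ensemble `(μ, θ)`; meaningful
when `HasFiniteInfo μ θ`. -/
def mutualInfo (μ : Measure ℂ) (θ : ℂ → Op ℕ) : ℝ :=
  (entropy (averageState μ θ)).toReal - ∫ z, (entropy (θ z)).toReal ∂μ

/-- Every integral and every entropy in `mutualInfo μ θ` exists and is finite. -/
def HasFiniteInfo (μ : Measure ℂ) (θ : ℂ → Op ℕ) : Prop :=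
  Integrable θ μ ∧ entropy (averageState μ θ) ≠ ∞ ∧ (∀ z, entropy (θ z) ≠ ∞) ∧
    Integrable (fun z => (entropy (θ z)).toReal) μ

/-- A real constellation: `m` points with a probability distribution on them. -/
structure Constellation (m : ℕ) where
  /-- the points -/
  point : Fin m → ℝ
  /-- their probabilities -/
  prob : Fin m → ℝ
  prob_nonneg : ∀ i, 0 ≤ prob i
  prob_sum : ∑ i, prob i = 1

namespace Constellation

variable {m : ℕ} (X : Constellation m)

/-- The mean of a real constellation. -/
def mean : ℝ := ∑ i, X.prob i * X.point i

/-- The variance of a real constellation. -/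
def variance : ℝ := ∑ i, X.prob i * (X.point i - X.mean) ^ 2

/-- The law `Q_{N,m}` of `Z_m = √(N/2) (X + i X')`, where `X` and `X'` are independent realizations
of the real constellation. -/
def complexLaw (N : ℝ) : Measure ℂ :=
  ∑ i, ∑ j, ENNReal.ofReal (X.prob i * X.prob j) •
    Measure.dirac ((Real.sqrt (N / 2) : ℂ) * ((X.point i : ℂ) + Complex.I * (X.point j : ℂ)))

end Constellation

end ThermalChannel

end

open ThermalChannel

/-! Every state involved is a classical mixture of coherent states, and the identity reduces to a
computation with second moments. The thermal ancilla is a Gaussian mixture of the `|w⟩⟨w|`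
(`inner_ket_cohMix_thermalLaw`, `tensorThermal_proj`), and the beamsplitter maps `|z⟩ ⊗ |w⟩` to the
product of coherent states with rotated amplitudes (`beamsplitter_coherent`). Tracing out one mode
leaves a Gaussian mixture of `|αz + γw⟩`, with `(α, γ)` equal to `(k, √(1-k²))` for `B`, `(-√(1-k²),
k)` for `E` and `(1, 1)` for additive noise. All three cases are thus instances of `gaussOutput`.
The outputs for different `z` differ by a displacement, which is isometric, so their entropy is the
same for all `z` (`entropy_gaussOutput`). The conditional entropies therefore cancel in the
difference of the two mutual informations, leaving the difference of the entropies of the average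
outputs. Under Gaussian modulation the average output is the thermal state of mean photon number
`α²N + γ²M`, where `M` is the noise variance (`affineLaw_thermalLaw`). Minus its logarithm is affine
in the photon number, so the cross entropy against it depends only on the trace and the mean photon
number of the other state (`tsum_neg_log_thermalProb_mul`). The constellation has the same mean
energy, so this cross entropy equals the entropy of the thermal state, and the relative entropy is
the difference of the two entropies (`relEntropy_cohMix`). Finite mean energy also makes every
entropy finite (`entropy_ne_top`). -/

namespace ThermalChannel

/-! ### The number basis -/

section NumberBasis

/-- The number basis as a Hilbert basis. -/
noncomputable def ketBasis (ι : Type) : HilbertBasis ι ℂ (Fock ι) :=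
  HilbertBasis.ofRepr (LinearIsometryEquiv.refl ℂ (lp (fun _ : ι => ℂ) 2))

theorem ketBasis_apply {ι : Type} [DecidableEq ι] (i : ι) : ketBasis ι i = ket i := by
  rw [← HilbertBasis.repr_symm_single]
  unfold ket ketBasis
  rfl

theorem inner_ket {ι : Type} [DecidableEq ι] (i : ι) (v : Fock ι) : ⟪ket i, v⟫_ℂ = (show lp (fun _ : ι => ℂ) 2 from v) i := by
  rw [← ketBasis_apply, ← HilbertBasis.repr_apply_apply]
  rfl

theorem norm_ket {ι : Type} [DecidableEq ι] (i : ι) : ‖(ket i : Fock ι)‖ = 1 := (orthonormal_ket ι).1 i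

theorem ext_inner_ket {ι : Type} [DecidableEq ι] {v w : Fock ι} (h : ∀ i, ⟪ket i, v⟫_ℂ = ⟪ket i, w⟫_ℂ) : v = w := by
  refine lp.ext (E := fun _ : ι => ℂ) (p := 2) (funext fun i => ?_)
  have := h i
  rwa [inner_ket, inner_ket] at this

theorem hasSum_ket {ι : Type} [DecidableEq ι] (v : Fock ι) : HasSum (fun i => ⟪ket i, v⟫_ℂ • ket i) v := by
  have h := (ketBasis ι).hasSum_repr v
  simpa only [HilbertBasis.repr_apply_apply, ketBasis_apply] using h

theorem hasSum_inner_mul_inner_ket {ι : Type} [DecidableEq ι] (v w : Fock ι) :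
    HasSum (fun i => ⟪v, ket i⟫_ℂ * ⟪ket i, w⟫_ℂ) ⟪v, w⟫_ℂ := by
  have h := (ketBasis ι).hasSum_inner_mul_inner v w
  simpa only [ketBasis_apply] using h

theorem hasSum_sq_norm_inner_ket {ι : Type} [DecidableEq ι] (v : Fock ι) :
    HasSum (fun i => ‖⟪ket i, v⟫_ℂ‖ ^ 2) (‖v‖ ^ 2) := by
  have h := (hasSum_inner_mul_inner_ket v v).mapL Complex.reCLM
  convert! h using 1
  · funext i
    rw [← inner_conj_symm v (ket i)]
    simp [← Complex.normSq_eq_conj_mul_self, Complex.normSq_eq_norm_sq, - inner_conj_symm]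
    norm_cast
  · rw [inner_self_eq_norm_sq_to_K]
    simp [← Complex.ofReal_pow]

theorem tsum_ofReal_sq_norm_inner_ket {ι : Type} [DecidableEq ι] (v : Fock ι) :
    ∑' i, ENNReal.ofReal (‖⟪ket i, v⟫_ℂ‖ ^ 2) = ENNReal.ofReal (‖v‖ ^ 2) := by
  rw [← ENNReal.ofReal_tsum_of_nonneg (fun i => by positivity)
    (hasSum_sq_norm_inner_ket v).summable, (hasSum_sq_norm_inner_ket v).tsum_eq]

theorem clm_ext_ket {ι : Type} [DecidableEq ι] {E : Type*} [NormedAddCommGroup E] [NormedSpace ℂ E] {A B : Fock ι →L[ℂ] E}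
    (h : ∀ i, A (ket i) = B (ket i)) : A = B := by
  ext v
  have hA := (hasSum_ket v).mapL A
  have hB := (hasSum_ket v).mapL B
  simp only [map_smul, h] at hA hB
  exact hA.unique hB

theorem op_ext_ket {ι κ : Type} [DecidableEq ι] [DecidableEq κ] {A B : Fock ι →L[ℂ] Fock κ}
    (h : ∀ i j, ⟪ket i, A (ket j)⟫_ℂ = ⟪ket i, B (ket j)⟫_ℂ) : A = B :=
  clm_ext_ket fun j => ext_inner_ket fun i => h i j

theorem isometryOf_norm {ι κ : Type} {v : ι → Fock κ} (hv : Orthonormal ℂ v) (x : Fock ι) :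
    ‖isometryOf hv x‖ = ‖x‖ :=
  (hv.orthogonalFamily.linearIsometry : lp (fun _ : ι => ℂ) 2 →ₗᵢ[ℂ] Fock κ).norm_map x

theorem proj_apply {ι : Type} (v x : Fock ι) : proj v x = ⟪v, x⟫_ℂ • v := rfl

theorem norm_proj {ι : Type} (v : Fock ι) : ‖proj v‖ = ‖v‖ ^ 2 := by
  rw [proj, InnerProductSpace.norm_rankOne, sq]

theorem comp_proj_comp_adjoint {ι κ : Type} (A : Fock ι →L[ℂ] Fock κ) (v : Fock ι) :
    A ∘L proj v ∘L ContinuousLinearMap.adjoint A = proj (A v) := by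
  ext1 x
  simp [proj_apply, ContinuousLinearMap.adjoint_inner_right]

theorem proj_smul {ι : Type} (c : ℂ) (v : Fock ι) : proj (c • v) = ((‖c‖ ^ 2 : ℝ) : ℂ) • proj v := by
  ext1 x
  simp only [proj_apply, smul_apply, inner_smul_left, smul_smul]
  congr 1
  rw [mul_right_comm, ← Complex.normSq_eq_conj_mul_self, Complex.normSq_eq_norm_sq]

theorem continuous_proj {ι : Type} : Continuous (proj : Fock ι → Op ι) := by
  have h : Continuous fun v : Fock ι => (innerSL ℂ v : Fock ι →L[ℂ] ℂ) :=
    (innerSL ℂ : Fock ι →L⋆[ℂ] Fock ι →L[ℂ] ℂ).continuous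
  exact (ContinuousLinearMap.smulRightL ℂ (Fock ι) (Fock ι)).continuous₂.comp
    (h.prodMk continuous_id)

theorem inner_ket_proj {ι : Type} [DecidableEq ι] (v : Fock ι) (i j : ι) :
    ⟪ket i, proj v (ket j)⟫_ℂ = ⟪ket i, v⟫_ℂ * (starRingEnd ℂ) ⟪ket j, v⟫_ℂ := by
  rw [proj_apply, inner_smul_right, inner_conj_symm, mul_comm]

end NumberBasis

/-! ### Product vectors -/

theorem memlp_tensor (v w : Fock ℕ) :
    Memℓp (fun p : ℕ × ℕ => ⟪ket p.1, v⟫_ℂ * ⟪ket p.2, w⟫_ℂ) 2 := by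
  refine memℓp_gen ?_
  have h := (hasSum_sq_norm_inner_ket v).summable.mul_of_nonneg
    (hasSum_sq_norm_inner_ket w).summable (fun _ => by positivity) (fun _ => by positivity)
  refine h.congr fun p => ?_
  simp [mul_pow]

/-- The product vector `v ⊗ w`. -/
noncomputable def tensorVec (v w : Fock ℕ) : Fock (ℕ × ℕ) :=
  (⟨fun p : ℕ × ℕ => ⟪ket p.1, v⟫_ℂ * ⟪ket p.2, w⟫_ℂ, memlp_tensor v w⟩ :
    lp (fun _ : ℕ × ℕ => ℂ) 2)

theorem inner_ket_tensorVec (v w : Fock ℕ) (p : ℕ × ℕ) :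
    ⟪ket p, tensorVec v w⟫_ℂ = ⟪ket p.1, v⟫_ℂ * ⟪ket p.2, w⟫_ℂ := by
  rw [inner_ket]
  rfl

theorem norm_tensorVec (v w : Fock ℕ) : ‖tensorVec v w‖ = ‖v‖ * ‖w‖ := by
  have h := (hasSum_sq_norm_inner_ket v).mul (hasSum_sq_norm_inner_ket w)
    ((hasSum_sq_norm_inner_ket v).summable.mul_of_nonneg
      (hasSum_sq_norm_inner_ket w).summable (fun _ => by positivity) (fun _ => by positivity))
  have h' := hasSum_sq_norm_inner_ket (tensorVec v w)
  simp only [inner_ket_tensorVec, norm_mul, mul_pow] at h'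
  have := h'.unique h
  rw [← mul_pow] at this
  exact (pow_left_inj₀ (by positivity) (by positivity) two_ne_zero).1 this

theorem tensorVec_sub (v w w' : Fock ℕ) :
    tensorVec v (w - w') = tensorVec v w - tensorVec v w' := by
  refine ext_inner_ket fun p => ?_
  simp only [inner_ket_tensorVec, inner_sub_right, mul_sub]

theorem continuous_tensorVec (v : Fock ℕ) : Continuous (tensorVec v) := by
  refine LipschitzWith.continuous (K := ‖v‖₊) (LipschitzWith.of_dist_le_mul fun w w' => ?_)
  rw [dist_eq_norm, dist_eq_norm, ← tensorVec_sub, norm_tensorVec, coe_nnnorm]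

theorem tensorKetRight_ket (n m : ℕ) : tensorKetRight n (ket m) = ket (m, n) :=
  isometryOf_ket _ m

theorem tensorKetLeft_ket (n m : ℕ) : tensorKetLeft m (ket n) = ket (m, n) :=
  isometryOf_ket _ n

theorem adjoint_tensorKetRight_tensorVec (n : ℕ) (v w : Fock ℕ) :
    ContinuousLinearMap.adjoint (tensorKetRight n) (tensorVec v w) = ⟪ket n, w⟫_ℂ • v := by
  refine ext_inner_ket fun m => ?_
  rw [ContinuousLinearMap.adjoint_inner_right, tensorKetRight_ket, inner_ket_tensorVec,
    inner_smul_right, mul_comm]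

theorem adjoint_tensorKetLeft_tensorVec (m : ℕ) (v w : Fock ℕ) :
    ContinuousLinearMap.adjoint (tensorKetLeft m) (tensorVec v w) = ⟪ket m, v⟫_ℂ • w := by
  refine ext_inner_ket fun n => ?_
  rw [ContinuousLinearMap.adjoint_inner_right, tensorKetLeft_ket, inner_ket_tensorVec,
    inner_smul_right]

theorem adjoint_tensorKetRight_ket (n : ℕ) (p : ℕ × ℕ) :
    ContinuousLinearMap.adjoint (tensorKetRight n) (ket p) = if p.2 = n then ket p.1 else 0 := by
  refine ext_inner_ket fun m => ?_
  rw [ContinuousLinearMap.adjoint_inner_right, tensorKetRight_ket, inner_ket_ket]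
  obtain ⟨a, b⟩ := p
  by_cases h : b = n
  · subst h; simp [inner_ket_ket]
  · simp [Ne.symm h, h]

/-! ### Coherent states -/

theorem inner_ket_coherent (n : ℕ) (z : ℂ) : ⟪ket n, coherent z⟫_ℂ =
    (Real.exp (-‖z‖ ^ 2 / 2) : ℂ) * (z ^ n / (Real.sqrt n.factorial : ℂ)) := by
  rw [inner_ket]
  rfl

/-- In the number basis the overlap is an exponential series. The closed form yields normalization,
continuity in the amplitude and the isometry of displacements. -/
theorem inner_coherent (z w : ℂ) : ⟪coherent z, coherent w⟫_ℂ =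
    Complex.exp (-(‖z‖ ^ 2 : ℝ) / 2 - (‖w‖ ^ 2 : ℝ) / 2 + (starRingEnd ℂ) z * w) := by
  have h := hasSum_inner_mul_inner_ket (coherent z) (coherent w)
  have h2 : HasSum (fun n : ℕ => ((starRingEnd ℂ) z * w) ^ n / (n.factorial : ℂ))
      (Complex.exp ((starRingEnd ℂ) z * w)) := by
    rw [Complex.exp_eq_exp_ℂ]
    exact NormedSpace.expSeries_div_hasSum_exp _
  have h3 := h2.mul_left ((Real.exp (-‖z‖ ^ 2 / 2) : ℂ) * (Real.exp (-‖w‖ ^ 2 / 2) : ℂ))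
  have : ⟪coherent z, coherent w⟫_ℂ = (Real.exp (-‖z‖ ^ 2 / 2) : ℂ) *
      (Real.exp (-‖w‖ ^ 2 / 2) : ℂ) * Complex.exp ((starRingEnd ℂ) z * w) := by
    refine h.unique (h3.congr_fun ?_)
    intro n
    rw [← inner_conj_symm, inner_ket_coherent, inner_ket_coherent]
    have hs := sqrt_mul_sqrt_cast (x := (n.factorial : ℝ)) (by positivity)
    have hn : ((n.factorial : ℝ) : ℂ) ≠ 0 := by exact_mod_cast n.factorial_ne_zero
    have hs0 : (Real.sqrt n.factorial : ℂ) ≠ 0 := by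
      intro h0; rw [h0] at hs; simp at hs; exact hn (by exact_mod_cast hs.symm)
    simp only [map_mul, map_div₀, Complex.conj_ofReal, map_pow]
    rw [show (n.factorial : ℂ) = ((n.factorial : ℝ) : ℂ) by simp, ← hs]
    field_simp
    ring
  rw [this, Complex.ofReal_exp, Complex.ofReal_exp, ← Complex.exp_add, ← Complex.exp_add]
  congr 1
  push_cast
  ring

theorem norm_coherent (z : ℂ) : ‖coherent z‖ = 1 := by
  have h := inner_coherent z z
  rw [inner_self_eq_norm_sq_to_K, ← Complex.normSq_eq_conj_mul_self,
    Complex.normSq_eq_norm_sq] at h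
  have h2 : (-(‖z‖ ^ 2 : ℝ) / 2 - (‖z‖ ^ 2 : ℝ) / 2 + ((‖z‖ ^ 2 : ℝ) : ℂ) : ℂ) = 0 := by
    push_cast; ring
  rw [h2, Complex.exp_zero] at h
  have h3 : ‖coherent z‖ ^ 2 = 1 := by
    have := congrArg Complex.re h
    simpa [← Complex.ofReal_pow] using this
  nlinarith [norm_nonneg (coherent z)]

theorem continuous_coherent : Continuous coherent := by
  rw [continuous_iff_continuousAt]
  intro z
  rw [ContinuousAt, tendsto_iff_norm_sub_tendsto_zero]
  -- Between unit vectors the distance is a function of the real part of the overlap, which is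
  -- explicit.
  have h : ∀ w, ‖coherent w - coherent z‖ = Real.sqrt (2 - 2 * (⟪coherent w, coherent z⟫_ℂ).re) := by
    intro w
    rw [← Real.sqrt_sq (norm_nonneg (coherent w - coherent z)), @norm_sub_sq ℂ]
    simp only [norm_coherent, RCLike.re_to_complex]
    ring_nf
  simp_rw [h]
  have hc : Continuous fun w => Real.sqrt (2 - 2 * (⟪coherent w, coherent z⟫_ℂ).re) := by
    simp_rw [inner_coherent]
    fun_prop
  have := hc.tendsto z
  rwa [← h z, sub_self, norm_zero] at this

theorem norm_proj_coherent (z : ℂ) : ‖proj (coherent z)‖ = 1 := by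
  rw [norm_proj, norm_coherent, one_pow]

theorem continuous_proj_coherent : Continuous fun z => proj (coherent z) :=
  continuous_proj.comp continuous_coherent

/-! ### Complex Gaussian laws -/

open ProbabilityTheory in
/-- The circularly symmetric complex Gaussian law with `E|w|² = M`; it is the point mass at `0` for
`M = 0`. -/
noncomputable def thermalLaw (M : ℝ) : Measure ℂ :=
  ((gaussianReal 0 (M / 2).toNNReal).prod (gaussianReal 0 (M / 2).toNNReal)).map
    Complex.measurableEquivRealProd.symm

instance (M : ℝ) : IsProbabilityMeasure (thermalLaw M) :=
  Measure.isProbabilityMeasure_map Complex.measurableEquivRealProd.symm.measurable.aemeasurable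

-- The radial density factors into two real Gaussian densities of variance `N / 2`. The product form
-- gives access to real characteristic functions and still makes sense for variance `0`, which is
-- needed when `N₀ = 0`.
open ProbabilityTheory in
theorem gaussLaw_eq_thermalLaw {N : ℝ} (hN : 0 < N) : gaussLaw N = thermalLaw N := by
  have hv : (N / 2).toNNReal ≠ 0 := by simpa using hN
  have hpi := Real.pi_pos
  rw [gaussLaw, thermalLaw, gaussianReal_of_var_ne_zero 0 hv,
    prod_withDensity (by fun_prop) (by fun_prop), ← Measure.volume_eq_prod]
  rw [← Complex.volume_preserving_equiv_real_prod.symm.map_eq]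
  refine Measure.ext fun s hs => ?_
  rw [withDensity_apply _ hs, Measure.map_apply (MeasurableEquiv.measurable _) hs,
    withDensity_apply _ (MeasurableEquiv.measurable _ hs),
    setLIntegral_map hs (by unfold gaussDensity; fun_prop) (MeasurableEquiv.measurable _)]
  refine lintegral_congr fun p => ?_
  rw [gaussianPDF, gaussianPDF, ← ENNReal.ofReal_mul (gaussianPDFReal_nonneg _ _ _)]
  congr 1
  rw [gaussianPDFReal, gaussianPDFReal, gaussDensity, Real.coe_toNNReal _ (by positivity),
    mul_mul_mul_comm, ← mul_inv, Real.mul_self_sqrt (by positivity), ← Real.exp_add,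
    ← Complex.normSq_eq_norm_sq, Complex.normSq_apply, Complex.measurableEquivRealProd_symm_apply]
  congr 2
  · ring
  · field_simp
    ring

theorem integral_thermalLaw {E : Type*} [NormedAddCommGroup E] [NormedSpace ℝ E] (M : ℝ)
    (f : ℂ → E) : ∫ w, f w ∂(thermalLaw M) =
      ∫ p : ℝ × ℝ, f (p.1 + p.2 * Complex.I) ∂((ProbabilityTheory.gaussianReal 0
        (M / 2).toNNReal).prod (ProbabilityTheory.gaussianReal 0 (M / 2).toNNReal)) := by
  rw [thermalLaw, integral_map_equiv]
  refine integral_congr_ae (ae_of_all _ fun p => ?_)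
  simp only [Complex.measurableEquivRealProd_symm_apply, Complex.mk_eq_add_mul_I]

open ProbabilityTheory in
theorem charFun_thermalLaw {M : ℝ} (hM : 0 ≤ M) (t : ℂ) :
    charFun (thermalLaw M) t = Complex.exp (-(M * ‖t‖ ^ 2 / 4 : ℝ)) := by
  rw [charFun_apply, integral_thermalLaw]
  have h : ∀ p : ℝ × ℝ, Complex.exp ((inner ℝ (p.1 + p.2 * Complex.I : ℂ) t : ℝ) * Complex.I) =
      Complex.exp (t.re * p.1 * Complex.I) * Complex.exp (t.im * p.2 * Complex.I) := by
    intro p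
    rw [← Complex.exp_add]
    congr 1
    rw [Complex.inner]
    simp
    ring
  simp_rw [h]
  rw [integral_prod_mul (fun x : ℝ => Complex.exp (t.re * x * Complex.I))
    (fun x : ℝ => Complex.exp (t.im * x * Complex.I)), ← charFun_apply_real, ← charFun_apply_real,
    charFun_gaussianReal, charFun_gaussianReal, ← Complex.exp_add, ← Complex.normSq_eq_norm_sq,
    Complex.normSq_apply]
  rw [Real.coe_toNNReal _ (by positivity)]
  congr 1
  push_cast
  ring

/-- The law of `α z + γ w` for independent `z` and `w` of laws `μ` and `ν`. -/
noncomputable def affineLaw (α γ : ℝ) (μ ν : Measure ℂ) : Measure ℂ :=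
  (μ.prod ν).map fun p => α * p.1 + γ * p.2

theorem measurable_affine (α γ : ℝ) :
    Measurable fun p : ℂ × ℂ => (α : ℂ) * p.1 + γ * p.2 := by fun_prop

instance (α γ : ℝ) (μ ν : Measure ℂ) [IsProbabilityMeasure μ] [IsProbabilityMeasure ν] :
    IsProbabilityMeasure (affineLaw α γ μ ν) :=
  Measure.isProbabilityMeasure_map (measurable_affine α γ).aemeasurable

/-- By independence the characteristic functions multiply and the variances add. This identifies the
average output under Gaussian modulation as a thermal state. -/
theorem affineLaw_thermalLaw (α γ : ℝ) {N M : ℝ} (hN : 0 ≤ N) (hM : 0 ≤ M) :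
    affineLaw α γ (thermalLaw N) (thermalLaw M) = thermalLaw (α ^ 2 * N + γ ^ 2 * M) := by
  refine Measure.ext_of_charFun (funext fun t => ?_)
  rw [charFun_thermalLaw (by positivity), charFun_apply, affineLaw,
    integral_map (measurable_affine α γ).aemeasurable (by fun_prop)]
  have h : ∀ p : ℂ × ℂ, Complex.exp ((inner ℝ ((α : ℂ) * p.1 + γ * p.2) t : ℝ) * Complex.I) =
      Complex.exp ((inner ℝ p.1 (α * t) : ℝ) * Complex.I) *
        Complex.exp ((inner ℝ p.2 (γ * t) : ℝ) * Complex.I) := by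
    intro p
    rw [← Complex.exp_add]
    congr 1
    simp only [Complex.inner]
    simp
    ring
  simp_rw [h]
  rw [integral_prod_mul (fun x : ℂ => Complex.exp ((inner ℝ x (α * t) : ℝ) * Complex.I))
    (fun x : ℂ => Complex.exp ((inner ℝ x (γ * t) : ℝ) * Complex.I)), ← charFun_apply,
    ← charFun_apply, charFun_thermalLaw hN, charFun_thermalLaw hM, ← Complex.exp_add]
  congr 1
  simp only [norm_mul, Complex.norm_real, mul_pow, Real.norm_eq_abs, sq_abs]
  push_cast
  ring

/-! ### Second moments and radial moments of the Gaussian laws. -/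

open ProbabilityTheory in
theorem lintegral_sq_gaussianReal (a γ : ℝ) (v : NNReal) :
    ∫⁻ x, ENNReal.ofReal ((a + γ * x) ^ 2) ∂(gaussianReal 0 v) =
      ENNReal.ofReal (a ^ 2 + γ ^ 2 * v) := by
  have h1 : Integrable (fun x : ℝ => x) (gaussianReal 0 v) :=
    (memLp_id_gaussianReal (μ := 0) (v := v) 1).integrable (by simp)
  have h2 : Integrable (fun x : ℝ => x ^ 2) (gaussianReal 0 v) :=
    (memLp_id_gaussianReal (μ := 0) (v := v) 2).integrable_sq
  have he : ∫ x, x ^ 2 ∂(gaussianReal 0 v) = v := by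
    have h := variance_id_gaussianReal (μ := 0) (v := v)
    rw [variance_eq_integral (by fun_prop)] at h
    simpa using h
  have hm : ∫ x, x ∂(gaussianReal 0 v) = 0 := integral_id_gaussianReal
  have h4 : Integrable (fun x : ℝ => (2 * a * γ) * x + γ ^ 2 * x ^ 2) (gaussianReal 0 v) :=
    (h1.const_mul _).add (h2.const_mul _)
  have h3 : Integrable (fun x : ℝ => a ^ 2 + ((2 * a * γ) * x + γ ^ 2 * x ^ 2))
      (gaussianReal 0 v) :=
    (integrable_const _).add h4
  have hs : ∀ x : ℝ, (a + γ * x) ^ 2 = a ^ 2 + ((2 * a * γ) * x + γ ^ 2 * x ^ 2) := fun x => by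
    ring
  simp_rw [hs]
  rw [← ofReal_integral_eq_lintegral_ofReal h3
    (ae_of_all _ fun x => by simp only [← hs x, Pi.zero_apply]; positivity),
    integral_add (integrable_const _) h4,
    integral_add (h1.const_mul _) (h2.const_mul _), integral_const_mul, integral_const_mul, he, hm]
  simp

open ProbabilityTheory in
theorem lintegral_sq_norm_thermalLaw (β : ℂ) (γ : ℝ) {M : ℝ} (hM : 0 ≤ M) :
    ∫⁻ w, ENNReal.ofReal (‖β + γ * w‖ ^ 2) ∂(thermalLaw M) =
      ENNReal.ofReal (‖β‖ ^ 2 + γ ^ 2 * M) := by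
  rw [thermalLaw, lintegral_map_equiv]
  have h : ∀ p : ℝ × ℝ, ENNReal.ofReal
      (‖β + γ * Complex.measurableEquivRealProd.symm p‖ ^ 2) =
      ENNReal.ofReal ((β.re + γ * p.1) ^ 2) + ENNReal.ofReal ((β.im + γ * p.2) ^ 2) := by
    intro p
    rw [← ENNReal.ofReal_add (by positivity) (by positivity), ← Complex.normSq_eq_norm_sq,
      Complex.normSq_apply, Complex.measurableEquivRealProd_symm_apply]
    simp [sq]
  simp_rw [h]
  rw [lintegral_add_left (by fun_prop)]
  rw [lintegral_prod _ (by fun_prop), lintegral_prod _ (by fun_prop)]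
  simp only [lintegral_const, measure_univ, mul_one, lintegral_sq_gaussianReal]
  rw [← ENNReal.ofReal_add (by positivity) (by positivity), ← Complex.normSq_eq_norm_sq,
      Complex.normSq_apply, Real.coe_toNNReal _ (by positivity)]
  congr 1
  ring

/-- The noise is centred, so the cross term vanishes and `μ` enters only through `E|z|²`; its mean
is irrelevant here. -/
theorem lintegral_sq_norm_affineLaw (α γ : ℝ) {N M : ℝ} (hN : 0 ≤ N) (hM : 0 ≤ M) {μ : Measure ℂ}
    [IsProbabilityMeasure μ] (hμ : ∫⁻ z, ENNReal.ofReal (‖z‖ ^ 2) ∂μ = ENNReal.ofReal N) :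
    ∫⁻ u, ENNReal.ofReal (‖u‖ ^ 2) ∂(affineLaw α γ μ (thermalLaw M)) =
      ENNReal.ofReal (α ^ 2 * N + γ ^ 2 * M) := by
  rw [affineLaw, lintegral_map (by fun_prop) (measurable_affine α γ),
    lintegral_prod _ (by fun_prop)]
  simp_rw [lintegral_sq_norm_thermalLaw _ γ hM]
  have h : ∀ z : ℂ, ENNReal.ofReal (‖α * z‖ ^ 2 + γ ^ 2 * M) =
      ENNReal.ofReal (α ^ 2) * ENNReal.ofReal (‖z‖ ^ 2) + ENNReal.ofReal (γ ^ 2 * M) := by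
    intro z
    rw [← ENNReal.ofReal_mul (by positivity), ← ENNReal.ofReal_add (by positivity) (by positivity)]
    simp [mul_pow]
  simp_rw [h]
  rw [lintegral_add_left (by fun_prop), lintegral_const_mul _ (by fun_prop), hμ]
  simp only [lintegral_const, measure_univ, mul_one]
  rw [← ENNReal.ofReal_mul (by positivity), ← ENNReal.ofReal_add (by positivity) (by positivity)]

/-- Rotation invariance of the complex Gaussian law. -/
theorem integral_gaussLaw_rotate {N : ℝ} (f : ℂ → ℂ) (c : Circle) :
    ∫ w, f (c * w) ∂(gaussLaw N) = ∫ w, f w ∂(gaussLaw N) := by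
  have h0 : ∀ g : ℂ → ℂ, ∫ w, g w ∂(gaussLaw N) =
      ∫ w, (ENNReal.ofReal (gaussDensity N w)).toReal • g w := fun g =>
    integral_withDensity_eq_integral_toReal_smul (by unfold gaussDensity; fun_prop)
      (ae_of_all _ fun _ => ENNReal.ofReal_lt_top) g
  rw [h0, h0]
  have hmp := (rotation c).measurePreserving
  rw [← hmp.integral_comp (rotation c).toHomeomorph.measurableEmbedding
    fun w => (ENNReal.ofReal (gaussDensity N w)).toReal • f w]
  simp only [gaussDensity, rotation_apply, norm_mul, Circle.norm_coe, one_mul]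

/-- The two exponentials combine to rate `1 + 1/N`, and the radial integral is a Gamma value: `n!
(N/(N+1))^(n+1) / N`. -/
theorem integral_gaussLaw_pow {N : ℝ} (hN : 0 < N) (n : ℕ) :
    ∫ w, Real.exp (-‖w‖ ^ 2) * ‖w‖ ^ (2 * n) ∂(gaussLaw N) =
      n.factorial * thermalProb N n := by
  have h0 : ∫ w, Real.exp (-‖w‖ ^ 2) * ‖w‖ ^ (2 * n) ∂(gaussLaw N) =
      ∫ w, (ENNReal.ofReal (gaussDensity N w)).toReal • (Real.exp (-‖w‖ ^ 2) * ‖w‖ ^ (2 * n)) :=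
    integral_withDensity_eq_integral_toReal_smul (by unfold gaussDensity; fun_prop)
      (ae_of_all _ fun _ => ENNReal.ofReal_lt_top) _
  have hb : 0 < 1 + 1 / N := by positivity
  have h1 := Complex.integral_rpow_mul_exp_neg_mul_rpow (p := 2) (q := 2 * n) (b := 1 + 1 / N)
    (by norm_num) (by have : (0 : ℝ) ≤ n := n.cast_nonneg
                      linarith) hb
  have h2 : ∀ w : ℂ, (ENNReal.ofReal (gaussDensity N w)).toReal •
      (Real.exp (-‖w‖ ^ 2) * ‖w‖ ^ (2 * n)) = (Real.pi * N)⁻¹ *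
        (‖w‖ ^ (2 * n : ℝ) * Real.exp (-(1 + 1 / N) * ‖w‖ ^ (2 : ℝ))) := by
    intro w
    rw [ENNReal.toReal_ofReal (by unfold gaussDensity; positivity), gaussDensity, smul_eq_mul,
      mul_assoc]
    have : (2 * n : ℝ) = ((2 * n : ℕ) : ℝ) := by push_cast; ring
    rw [this, Real.rpow_natCast, Real.rpow_two, mul_comm (‖w‖ ^ (2 * n)), ← mul_assoc (Real.exp _),
      ← Real.exp_add]
    congr 3
    field_simp
    ring
  rw [h0]
  simp_rw [h2]
  rw [integral_const_mul, h1]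
  have h3 : ((2 * n + 2) / 2 : ℝ) = n + 1 := by ring
  have h4 : (-(2 * n + 2) / 2 : ℝ) = -((n + 1 : ℕ) : ℝ) := by push_cast; ring
  rw [h3, h4, Real.Gamma_nat_eq_factorial, Real.rpow_neg hb.le, Real.rpow_natCast, thermalProb]
  have := Real.pi_ne_zero
  have h5 : 1 + 1 / N = (N + 1) / N := by field_simp
  rw [h5]
  have : N + 1 ≠ 0 := by positivity
  rw [div_pow, div_pow]
  field_simp
  ring

/-! ### Mixtures of coherent states -/

theorem integrable_of_continuous_of_norm_le {E : Type*} [NormedAddCommGroup E] {μ : Measure ℂ}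
    [IsFiniteMeasure μ] {f : ℂ → E} (hf : Continuous f) (C : ℝ) (h : ∀ z, ‖f z‖ ≤ C) :
    Integrable f μ :=
  Integrable.of_bound hf.aestronglyMeasurable C (ae_of_all _ h)

/-- The matrix element `T ↦ ⟨v, T w⟩`. -/
noncomputable def matElem {ι : Type} (v w : Fock ι) : Op ι →L[ℂ] ℂ :=
  (innerSL ℂ v) ∘L (ContinuousLinearMap.apply ℂ (Fock ι) w)

theorem matElem_apply {ι : Type} (v w : Fock ι) (T : Op ι) : matElem v w T = ⟪v, T w⟫_ℂ := rfl

theorem inner_integral_op {ι : Type} {μ : Measure ℂ} {f : ℂ → Op ι} (hf : Integrable f μ)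
    (v w : Fock ι) : ⟪v, (∫ z, f z ∂μ) w⟫_ℂ = ∫ z, ⟪v, f z w⟫_ℂ ∂μ := by
  rw [← matElem_apply, ← ContinuousLinearMap.integral_comp_comm _ hf]
  rfl

/-- The mixture `∫ |u⟩⟨u| dμ(u)` of coherent states. -/
noncomputable def cohMix (μ : Measure ℂ) : Op ℕ := ∫ u, proj (coherent u) ∂μ

theorem integrable_proj_coherent (μ : Measure ℂ) [IsFiniteMeasure μ] :
    Integrable (fun u => proj (coherent u)) μ :=
  integrable_of_continuous_of_norm_le continuous_proj_coherent 1 fun z => (norm_proj_coherent z).le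

theorem inner_cohMix (μ : Measure ℂ) [IsFiniteMeasure μ] (v w : Fock ℕ) :
    ⟪v, cohMix μ w⟫_ℂ = ∫ u, ⟪v, coherent u⟫_ℂ * ⟪coherent u, w⟫_ℂ ∂μ := by
  rw [cohMix, inner_integral_op (integrable_proj_coherent μ)]
  simp only [proj_apply, inner_smul_right, mul_comm]

theorem thermalLaw_zero : thermalLaw 0 = Measure.dirac 0 := by
  rw [thermalLaw]
  simp only [zero_div, Real.toNNReal_zero, ProbabilityTheory.gaussianReal_zero_var]
  rw [Measure.dirac_prod_dirac, Measure.map_dirac' (MeasurableEquiv.measurable _)]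
  simp only [Complex.measurableEquivRealProd_symm_apply]
  rfl

theorem sqrt_factorial_mul_self (n : ℕ) :
    (Real.sqrt n.factorial : ℂ) * (Real.sqrt n.factorial : ℂ) = n.factorial := by
  rw [sqrt_mul_sqrt_cast (by positivity)]
  simp

theorem sqrt_factorial_ne_zero (n : ℕ) : (Real.sqrt n.factorial : ℂ) ≠ 0 := by
  have : (Real.sqrt n.factorial) ≠ 0 := by positivity
  exact_mod_cast this

theorem sq_norm_inner_ket_coherent (n : ℕ) (z : ℂ) : ‖⟪ket n, coherent z⟫_ℂ‖ ^ 2 =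
    Real.exp (-‖z‖ ^ 2) * ‖z‖ ^ (2 * n) / n.factorial := by
  rw [inner_ket_coherent]
  simp only [norm_mul, norm_div, norm_pow, Complex.norm_real, Real.norm_eq_abs, mul_pow, div_pow,
    sq_abs]
  rw [Real.sq_sqrt (by positivity), ← Real.exp_nat_mul, ← pow_mul, mul_comm n 2, ← mul_div_assoc]
  congr 4
  push_cast
  ring

theorem exists_circle_pow_ne {i j : ℕ} (h : i ≠ j) :
    ∃ c : Circle, (c : ℂ) ^ i * (starRingEnd ℂ) ((c : ℂ) ^ j) ≠ 1 := by
  -- An angle of one radian works for all pairs at once: the phase `exp(√-1 (i - j))` is `1` only if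
  -- `i - j` is an integer multiple of `2π`, and `π` is irrational.
  refine ⟨Circle.exp 1, fun h1 => h ?_⟩
  have h2 : Complex.exp (((i : ℝ) - j : ℝ) * Complex.I) = 1 := by
    rw [← h1, Circle.coe_exp, map_pow, ← Complex.exp_conj, ← Complex.exp_nat_mul,
      ← Complex.exp_nat_mul, ← Complex.exp_add]
    congr 1
    simp
    ring
  obtain ⟨n, hn⟩ := Complex.exp_eq_one_iff.1 h2
  have h3 : ((i : ℝ) - j) = n * (2 * Real.pi) := by
    have := congrArg Complex.im hn
    simpa using this
  by_contra hij
  have hn0 : n ≠ 0 := by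
    rintro rfl
    simp only [Int.cast_zero, zero_mul, sub_eq_zero, Nat.cast_inj] at h3
    exact hij h3
  refine (irrational_pi.intCast_mul (m := 2 * n) (by simpa using hn0)).ne_int ((i : ℤ) - j) ?_
  push_cast
  linarith

/-- Diagonal entries are the radial moments. Rotating the integration variable multiplies the `(i,
j)` entry by a phase, which can be chosen different from `1` when `i ≠ j`, so off-diagonal entries
vanish. -/
theorem inner_ket_cohMix_thermalLaw {M : ℝ} (hM : 0 ≤ M) (i j : ℕ) :
    ⟪ket i, cohMix (thermalLaw M) (ket j)⟫_ℂ = if i = j then (thermalProb M i : ℂ) else 0 := by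
  rw [inner_cohMix]
  rcases hM.eq_or_lt with rfl | hM
  -- At `M = 0` the mixture is the vacuum, and `thermalProb 0` is the indicator of `0` because `0 ^
  -- 0 = 1`.
  · rw [thermalLaw_zero, integral_dirac, ← inner_conj_symm _ (ket j), inner_ket_coherent,
      inner_ket_coherent]
    rcases i with _ | i
    · rcases j with _ | j <;> simp [thermalProb]
    · simp [thermalProb]
  rw [← gaussLaw_eq_thermalLaw hM]
  by_cases h : i = j
  · subst h
    rw [if_pos rfl]
    have h1 : ∀ u : ℂ, ⟪ket i, coherent u⟫_ℂ * ⟪coherent u, ket i⟫_ℂ =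
        ((Real.exp (-‖u‖ ^ 2) * ‖u‖ ^ (2 * i) * (i.factorial : ℝ)⁻¹ : ℝ) : ℂ) := by
      intro u
      rw [← inner_conj_symm (coherent u), Complex.mul_conj, Complex.normSq_eq_norm_sq,
        sq_norm_inner_ket_coherent, div_eq_mul_inv]
    simp_rw [h1]
    rw [integral_complex_ofReal, integral_mul_const, integral_gaussLaw_pow hM]
    congr 1
    have : (i.factorial : ℝ) ≠ 0 := by positivity
    field_simp
  · rw [if_neg h]
    obtain ⟨c, hc⟩ := exists_circle_pow_ne h
    have h1 := integral_gaussLaw_rotate (N := M)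
      (fun u => ⟪ket i, coherent u⟫_ℂ * ⟪coherent u, ket j⟫_ℂ) c
    have h2 : ∀ u : ℂ, ⟪ket i, coherent (c * u)⟫_ℂ * ⟪coherent (c * u), ket j⟫_ℂ =
        ((c : ℂ) ^ i * (starRingEnd ℂ) ((c : ℂ) ^ j)) *
          (⟪ket i, coherent u⟫_ℂ * ⟪coherent u, ket j⟫_ℂ) := by
      intro u
      rw [← inner_conj_symm _ (ket j), ← inner_conj_symm _ (ket j), inner_ket_coherent,
        inner_ket_coherent, inner_ket_coherent, inner_ket_coherent]
      simp only [norm_mul, Circle.norm_coe, one_mul, mul_pow, map_mul, map_div₀]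
      ring
    simp_rw [h2] at h1
    rw [integral_const_mul] at h1
    by_contra h0
    exact hc (mul_right_cancel₀ h0 (h1.trans (one_mul _).symm))

theorem cohMix_thermalLaw_ket {M : ℝ} (hM : 0 ≤ M) (j : ℕ) :
    cohMix (thermalLaw M) (ket j) = (thermalProb M j : ℂ) • ket j := by
  refine ext_inner_ket fun i => ?_
  rw [inner_ket_cohMix_thermalLaw hM, inner_smul_right, inner_ket_ket]
  split_ifs with h <;> simp [h]

/-! ### Total mass and mean photon number of a mixture of coherent states. -/

theorem ofReal_inner_ket_cohMix (μ : Measure ℂ) [IsFiniteMeasure μ] (n : ℕ) :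
    ENNReal.ofReal (⟪ket n, cohMix μ (ket n)⟫_ℂ).re =
      ∫⁻ u, ENNReal.ofReal (‖⟪ket n, coherent u⟫_ℂ‖ ^ 2) ∂μ := by
  have h1 : ∀ u : ℂ, ⟪ket n, coherent u⟫_ℂ * ⟪coherent u, ket n⟫_ℂ =
      ((‖⟪ket n, coherent u⟫_ℂ‖ ^ 2 : ℝ) : ℂ) := by
    intro u
    rw [← inner_conj_symm (coherent u), Complex.mul_conj, Complex.normSq_eq_norm_sq]
  rw [inner_cohMix]
  simp_rw [h1]
  rw [integral_complex_ofReal, Complex.ofReal_re, ofReal_integral_eq_lintegral_ofReal _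
    (ae_of_all _ fun u => by positivity)]
  refine integrable_of_continuous_of_norm_le ?_ 1 fun z => ?_
  · exact (continuous_const.inner continuous_coherent).norm.pow 2
  · rw [Real.norm_of_nonneg (by positivity)]
    have := norm_inner_le_norm (𝕜 := ℂ) (ket n) (coherent z)
    rw [norm_ket, norm_coherent, one_mul] at this
    exact pow_le_one₀ (norm_nonneg _) this

theorem measurable_sq_norm_inner_ket_coherent (n : ℕ) :
    Measurable fun u => ENNReal.ofReal (‖⟪ket n, coherent u⟫_ℂ‖ ^ 2) :=
  ENNReal.measurable_ofReal.comp
    ((continuous_const.inner continuous_coherent).norm.pow 2).measurable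

theorem tsum_inner_ket_cohMix (μ : Measure ℂ) [IsProbabilityMeasure μ] :
    ∑' n, ENNReal.ofReal (⟪ket n, cohMix μ (ket n)⟫_ℂ).re = 1 := by
  simp_rw [ofReal_inner_ket_cohMix]
  rw [← lintegral_tsum fun n => (measurable_sq_norm_inner_ket_coherent n).aemeasurable]
  simp_rw [tsum_ofReal_sq_norm_inner_ket, norm_coherent]
  simp

/-- The photon number in `|u⟩` is Poisson with mean `|u|²`: the term at `n = 0` drops out, and `n +
1` times the weight at `n + 1` is `|u|²` times the weight at `n`. -/
theorem tsum_mul_sq_norm_inner_ket_coherent (u : ℂ) :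
    ∑' n : ℕ, ENNReal.ofReal n * ENNReal.ofReal (‖⟪ket n, coherent u⟫_ℂ‖ ^ 2) =
      ENNReal.ofReal (‖u‖ ^ 2) := by
  rw [tsum_eq_zero_add' ENNReal.summable]
  have h : ∀ n : ℕ, ENNReal.ofReal (n + 1 : ℕ) *
      ENNReal.ofReal (‖⟪ket (n + 1), coherent u⟫_ℂ‖ ^ 2) =
      ENNReal.ofReal (‖u‖ ^ 2) * ENNReal.ofReal (‖⟪ket n, coherent u⟫_ℂ‖ ^ 2) := by
    intro n
    rw [← ENNReal.ofReal_mul (by positivity), ← ENNReal.ofReal_mul (by positivity)]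
    congr 1
    rw [sq_norm_inner_ket_coherent, sq_norm_inner_ket_coherent, Nat.factorial_succ]
    push_cast
    field_simp
    ring
  simp_rw [h]
  rw [ENNReal.tsum_mul_left, tsum_ofReal_sq_norm_inner_ket, norm_coherent]
  simp

theorem tsum_mul_inner_ket_cohMix (μ : Measure ℂ) [IsFiniteMeasure μ] :
    ∑' n : ℕ, ENNReal.ofReal n * ENNReal.ofReal (⟪ket n, cohMix μ (ket n)⟫_ℂ).re =
      ∫⁻ u, ENNReal.ofReal (‖u‖ ^ 2) ∂μ := by
  simp_rw [ofReal_inner_ket_cohMix]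
  rw [← lintegral_congr tsum_mul_sq_norm_inner_ket_coherent]
  rw [lintegral_tsum fun n =>
    ((measurable_sq_norm_inner_ket_coherent n).const_mul _).aemeasurable]
  refine tsum_congr fun n => ?_
  rw [lintegral_const_mul _ (measurable_sq_norm_inner_ket_coherent n)]

theorem cohMix_nonneg (μ : Measure ℂ) [IsFiniteMeasure μ] : 0 ≤ cohMix μ := by
  rw [ContinuousLinearMap.nonneg_iff_isPositive, ContinuousLinearMap.isPositive_iff_complex]
  intro v
  have h1 : ∀ u : ℂ, ⟪v, coherent u⟫_ℂ * ⟪coherent u, v⟫_ℂ =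
      ((‖⟪v, coherent u⟫_ℂ‖ ^ 2 : ℝ) : ℂ) := by
    intro u
    rw [← inner_conj_symm (coherent u), Complex.mul_conj, Complex.normSq_eq_norm_sq]
  rw [← inner_conj_symm, inner_cohMix]
  simp_rw [h1]
  rw [integral_complex_ofReal, Complex.conj_ofReal]
  exact ⟨by simp, integral_nonneg fun u => by positivity⟩

/-- Coherent states span a dense subspace. -/
theorem eq_zero_of_inner_coherent {v : Fock ℕ} (h : ∀ z, ⟪coherent z, v⟫_ℂ = 0) : v = 0 := by
  -- A vector orthogonal to all coherent states is killed by every mixture of them, in particular by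
  -- a thermal state, which is diagonal with strictly positive eigenvalues.
  have h1 : cohMix (thermalLaw 1) v = 0 := by
    refine ext_inner_ket fun i => ?_
    rw [inner_cohMix]
    simp [h]
  refine ext_inner_ket fun i => ?_
  have hpos : (thermalProb 1 i : ℂ) ≠ 0 := by
    have : thermalProb 1 i ≠ 0 := by unfold thermalProb; positivity
    exact_mod_cast this
  have h2 : ⟪cohMix (thermalLaw 1) (ket i), v⟫_ℂ = 0 := by
    rw [← inner_conj_symm, inner_cohMix]
    simp [← inner_conj_symm v, h]
  rw [cohMix_thermalLaw_ket zero_le_one, inner_smul_left] at h2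
  rw [inner_zero_right]
  refine (mul_eq_zero.1 h2).resolve_left ?_
  simpa using hpos

/-! ### The functional calculus on eigenvectors -/

theorem mem_spectrum_of_apply_eq_smul {ι : Type} {T : Op ι} {v : Fock ι} (hv : v ≠ 0) {t : ℝ}
    (h : T v = (t : ℂ) • v) : t ∈ spectrum ℝ T := by
  rw [spectrum.mem_iff]
  intro hu
  apply hv
  obtain ⟨u, hu⟩ := hu
  have h1 : (u : Op ι) v = 0 := by
    rw [hu]
    simp [Algebra.algebraMap_eq_smul_one, h]
  have h2 : ((u⁻¹ : (Op ι)ˣ) : Op ι) ((u : Op ι) v) = v := by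
    rw [← mul_apply_eq_comp, Units.inv_mul, one_apply_eq_self]
  rw [← h2, h1, map_zero]

/-- Stone–Weierstrass: the functions `g` for which `g(T) v = g(t) v` form a closed subalgebra
containing the constants and the identity. -/
theorem cfc_apply_of_apply_eq_smul {ι : Type} {T : Op ι} (hT : IsSelfAdjoint T) {v : Fock ι}
    {t : ℝ} (h : T v = (t : ℂ) • v) {f : ℝ → ℝ} (hf : ContinuousOn f (spectrum ℝ T)) :
    cfc f T v = (f t : ℂ) • v := by
  by_cases hv : v = 0
  · simp [hv]
  have ht := mem_spectrum_of_apply_eq_smul hv h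
  have key : ∀ g : C(spectrum ℝ T, ℝ), cfcHom hT g v = ((g ⟨t, ht⟩ : ℝ) : ℂ) • v := by
    intro g
    induction g using ContinuousMap.induction_on_of_compact with
    | const r =>
      have : ContinuousMap.const (spectrum ℝ T) r = algebraMap ℝ C(spectrum ℝ T, ℝ) r := rfl
      rw [this, AlgHomClass.commutes]
      simp [Algebra.algebraMap_eq_smul_one]
    | id =>
      rw [cfcHom_id hT]
      simpa using h
    | star_id =>
      rw [map_star, cfcHom_id hT, hT.star_eq]
      simpa using h
    | add f g hf hg => simp [hf, hg, add_smul]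
    | mul f g hf hg =>
      simp only [map_mul, mul_apply_eq_comp, hf, hg, map_smul, smul_smul, ContinuousMap.mul_apply,
        Complex.ofReal_mul, mul_comm]
    | frequently f hf =>
      have hc : IsClosed {g : C(spectrum ℝ T, ℝ) |
          cfcHom hT g v = ((g ⟨t, ht⟩ : ℝ) : ℂ) • v} := by
        refine isClosed_eq ?_ ?_
        · exact (cfcHom_continuous hT).clm_apply continuous_const
        · exact (Complex.continuous_ofReal.comp
            (continuous_eval_const _)).smul continuous_const
      exact hc.mem_of_frequently_of_tendsto hf Filter.tendsto_id
  rw [cfc_apply f T hT hf, key]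
  rfl

/-! ### Entropic quantities of diagonal operators -/

theorem entropy_of_diagonal {T : Op ℕ} (hT : IsSelfAdjoint T) {t : ℕ → ℝ}
    (h : ∀ n, T (ket n) = (t n : ℂ) • ket n) :
    entropy T = ∑' n, ENNReal.ofReal (Real.negMulLog (t n)) := by
  refine tsum_congr fun n => ?_
  rw [cfc_apply_of_apply_eq_smul hT (h n) Real.continuous_negMulLog.continuousOn,
    inner_smul_right, inner_ket_ket]
  simp

theorem continuous_sqrt_neg_log_max {ε : ℝ} (hε : 0 < ε) :
    Continuous fun x : ℝ => Real.sqrt (-Real.log (max x ε)) :=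
  ((continuous_id.max continuous_const).log fun _ => (lt_max_of_lt_right hε).ne').neg.sqrt

theorem posTrace_sqrtNegLog {ρ σ : Op ℕ} (hσ : IsSelfAdjoint σ) {t : ℕ → ℝ} (ht : ∀ n, t n ≤ 1)
    (h : ∀ n, σ (ket n) = (t n : ℂ) • ket n) {ε : ℝ} (hε : ε ∈ Set.Ioc (0 : ℝ) 1) :
    posTrace (sqrtNegLog ε σ * ρ * sqrtNegLog ε σ) =
      ∑' n, ENNReal.ofReal (-Real.log (max (t n) ε)) * ENNReal.ofReal (⟪ket n, ρ (ket n)⟫_ℂ).re := by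
  refine tsum_congr fun n => ?_
  have hS : IsSelfAdjoint (sqrtNegLog ε σ) := cfc_predicate _ _
  have h1 : sqrtNegLog ε σ (ket n) = (Real.sqrt (-Real.log (max (t n) ε)) : ℂ) • ket n :=
    cfc_apply_of_apply_eq_smul hσ (h n) (continuous_sqrt_neg_log_max hε.1).continuousOn
  have h0 : 0 ≤ -Real.log (max (t n) ε) := by
    have := Real.log_nonpos (le_max_of_le_right hε.1.le) (max_le (ht n) hε.2)
    linarith
  rw [mul_apply_eq_comp, mul_apply_eq_comp,
    ← ContinuousLinearMap.adjoint_inner_left, ← ContinuousLinearMap.star_eq_adjoint, hS.star_eq,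
    h1, map_smul, inner_smul_left, inner_smul_right, Complex.conj_ofReal, ← mul_assoc,
    sqrt_mul_sqrt_cast h0, Complex.re_ofReal_mul, ENNReal.ofReal_mul h0]

/-- Supplies a cutoff below all the positive eigenvalues in a finite set, so that truncation does
not affect a given partial sum. -/
theorem exists_le_of_pos (t : ℕ → ℝ) (s : Finset ℕ) :
    ∃ ε ∈ Set.Ioc (0 : ℝ) 1, ∀ n ∈ s, 0 < t n → ε ≤ t n := by
  induction s using Finset.induction_on with
  | empty => exact ⟨1, by simp, by simp⟩
  | insert a s _ ih =>
    obtain ⟨ε, hε, h⟩ := ih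
    by_cases ha : 0 < t a
    · refine ⟨min ε (t a), ⟨lt_min hε.1 ha, (min_le_left _ _).trans hε.2⟩, fun n hn hp => ?_⟩
      rcases Finset.mem_insert.1 hn with rfl | hn
      · exact min_le_right _ _
      · exact (min_le_left _ _).trans (h n hn hp)
    · refine ⟨ε, hε, fun n hn hp => ?_⟩
      rcases Finset.mem_insert.1 hn with rfl | hn
      · exact absurd hp ha
      · exact h n hn hp

/-- Truncation only lowers `-log t n`, and on each finite set of indices a small cutoff is inactive.
The support condition `hac` is essential: since `Real.log 0 = 0`, the right side gives no penalty
where `σ` vanishes, whereas the cross entropy would be infinite. -/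
theorem crossEntropy_of_diagonal {ρ σ : Op ℕ} (hσ : IsSelfAdjoint σ) {t : ℕ → ℝ}
    (ht0 : ∀ n, 0 ≤ t n) (ht : ∀ n, t n ≤ 1) (h : ∀ n, σ (ket n) = (t n : ℂ) • ket n)
    (hac : ∀ n, t n = 0 → ENNReal.ofReal (⟪ket n, ρ (ket n)⟫_ℂ).re = 0) :
    crossEntropy ρ σ =
      ∑' n, ENNReal.ofReal (-Real.log (t n)) * ENNReal.ofReal (⟪ket n, ρ (ket n)⟫_ℂ).re := by
  apply le_antisymm
  · refine iSup₂_le fun ε hε => ?_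
    rw [posTrace_sqrtNegLog hσ ht h hε]
    refine ENNReal.tsum_le_tsum fun n => ?_
    rcases (ht0 n).eq_or_lt with h0 | h0
    · simp [hac n h0.symm]
    · gcongr
      exact le_max_left _ _
  · rw [ENNReal.tsum_eq_iSup_sum]
    refine iSup_le fun s => ?_
    obtain ⟨ε, hε, hs⟩ := exists_le_of_pos t s
    refine le_trans ?_ (le_iSup₂ ε hε)
    rw [posTrace_sqrtNegLog hσ ht h hε]
    refine le_trans (Finset.sum_le_sum fun n hn => ?_) (ENNReal.sum_le_tsum s)
    rcases (ht0 n).eq_or_lt with h0 | h0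
    · simp [hac n h0.symm]
    · rw [max_eq_left (hs n hn h0)]

/-! ### Finiteness of the entropy -/

theorem re_inner_le_of_le {ι : Type} {A B : Op ι} (h : A ≤ B) (v : Fock ι) :
    (⟪v, A v⟫_ℂ).re ≤ (⟪v, B v⟫_ℂ).re := by
  have h1 := ((ContinuousLinearMap.le_def A B).1 h).re_inner_nonneg_right v
  simp only [sub_apply, inner_sub_right, map_sub, RCLike.re_to_complex] at h1
  linarith

/-- The right side is the tangent line at `t` of the concave function `-x log x`. -/
theorem negMulLog_le_of_pos {x t : ℝ} (hx : 0 ≤ x) (ht : 0 < t) :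
    Real.negMulLog x ≤ (-Real.log t - 1) * x + t := by
  rcases hx.eq_or_lt with rfl | hx
  · simpa using ht.le
  · have h := Real.log_le_sub_one_of_pos (div_pos ht hx)
    rw [Real.log_div ht.ne' hx.ne'] at h
    have h2 := mul_le_mul_of_nonneg_left h hx.le
    have h3 : x * (t / x - 1) = t - x := by field_simp
    rw [Real.negMulLog]
    nlinarith

/-- The tangent bound passes through the functional calculus, so diagonal entries of `-T log T` are
controlled by those of `T` without diagonalizing `T`. -/
theorem re_inner_cfc_negMulLog_le {T : Op ℕ} (hT : 0 ≤ T) (n : ℕ) {t : ℝ} (ht : 0 < t) :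
    (⟪ket n, cfc Real.negMulLog T (ket n)⟫_ℂ).re ≤
      (-Real.log t - 1) * (⟪ket n, T (ket n)⟫_ℂ).re + t := by
  have hs : IsSelfAdjoint T := IsSelfAdjoint.of_nonneg hT
  have h1 : cfc Real.negMulLog T ≤ cfc (fun x => (-Real.log t - 1) * x + t) T :=
    cfc_mono (fun x hx => negMulLog_le_of_pos (spectrum_nonneg_of_nonneg hT hx) ht)
      Real.continuous_negMulLog.continuousOn (by fun_prop)
  have h2 : cfc (fun x => (-Real.log t - 1) * x + t) T =
      (-Real.log t - 1) • T + algebraMap ℝ (Op ℕ) t := by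
    rw [cfc_add_const t _ T (by fun_prop) hs, cfc_const_mul_id _ T hs]
  rw [h2] at h1
  refine (re_inner_le_of_le h1 (ket n)).trans_eq ?_
  rw [add_apply, inner_add_right, Complex.add_re, Algebra.algebraMap_eq_smul_one, smul_apply,
    smul_apply, ← Complex.coe_smul, ← Complex.coe_smul, inner_smul_right, inner_smul_right,
    Complex.re_ofReal_mul, Complex.re_ofReal_mul, one_apply_eq_self, inner_ket_ket]
  simp

theorem thermalProb_pos {M : ℝ} (hM : 0 < M) (n : ℕ) : 0 < thermalProb M n := by
  unfold thermalProb; positivity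

theorem thermalProb_nonneg {M : ℝ} (hM : 0 ≤ M) (n : ℕ) : 0 ≤ thermalProb M n := by
  unfold thermalProb; positivity

theorem thermalProb_le_one {M : ℝ} (hM : 0 ≤ M) (n : ℕ) : thermalProb M n ≤ 1 := by
  unfold thermalProb
  refine mul_le_one₀ ?_ (by positivity) (pow_le_one₀ (by positivity) ?_)
  · rw [div_le_one (by positivity)]; linarith
  · rw [div_le_one (by positivity)]; linarith

theorem neg_log_thermalProb {M : ℝ} (hM : 0 ≤ M) (n : ℕ) :
    -Real.log (thermalProb M n) = Real.log (M + 1) + n * Real.log ((M + 1) / M) := by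
  unfold thermalProb
  rcases hM.eq_or_lt with rfl | hM
  -- At `M = 0` both sides are `0`, by the conventions `Real.log 0 = 0` and `x / 0 = 0`.
  · rcases n with _ | n <;> simp
  · rw [Real.log_mul (by positivity) (by positivity), Real.log_pow, one_div, Real.log_inv,
      ← inv_div, Real.log_inv]
    ring

theorem log_ratio_nonneg {M : ℝ} (hM : 0 ≤ M) : 0 ≤ Real.log ((M + 1) / M) := by
  rcases hM.eq_or_lt with rfl | hM
  · simp
  · refine Real.log_nonneg ?_
    rw [one_le_div hM]
    linarith

/-- `-∑ pₙ log tₙ` for the photon number distribution `t` of a thermal state depends only on the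
mass and the mean of `p`. -/
theorem tsum_neg_log_thermalProb_mul {M : ℝ} (hM : 0 ≤ M) (p : ℕ → ℝ≥0∞) :
    ∑' n, ENNReal.ofReal (-Real.log (thermalProb M n)) * p n =
      ENNReal.ofReal (Real.log (M + 1)) * ∑' n, p n +
        ENNReal.ofReal (Real.log ((M + 1) / M)) * ∑' n : ℕ, ENNReal.ofReal n * p n := by
  have h1 : 0 ≤ Real.log (M + 1) := Real.log_nonneg (by linarith)
  have h2 := log_ratio_nonneg hM
  rw [← ENNReal.tsum_mul_left, ← ENNReal.tsum_mul_left, ← ENNReal.tsum_add]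
  refine tsum_congr fun n => ?_
  rw [neg_log_thermalProb hM, ENNReal.ofReal_add h1 (by positivity),
    ENNReal.ofReal_mul (by positivity)]
  ring

theorem summable_thermalProb {M : ℝ} (hM : 0 ≤ M) : Summable (thermalProb M) := by
  refine (summable_geometric_of_lt_one (by positivity) ?_).mul_left _
  rw [div_lt_one (by positivity)]
  linarith

/-- The tangent bound is used at a different point for each `n`, the geometric weight `thermalProb 1
n`. Its slope grows linearly in `n` and its constant terms are summable, so finite trace and finite
mean photon number suffice. -/
theorem entropy_ne_top {T : Op ℕ} (hT : 0 ≤ T)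
    (h1 : ∑' n, ENNReal.ofReal (⟪ket n, T (ket n)⟫_ℂ).re ≠ ∞)
    (h2 : ∑' n : ℕ, ENNReal.ofReal n * ENNReal.ofReal (⟪ket n, T (ket n)⟫_ℂ).re ≠ ∞) :
    entropy T ≠ ∞ := by
  have hle : entropy T ≤ ∑' n, (ENNReal.ofReal (-Real.log (thermalProb 1 n)) *
      ENNReal.ofReal (⟪ket n, T (ket n)⟫_ℂ).re + ENNReal.ofReal (thermalProb 1 n)) := by
    refine ENNReal.tsum_le_tsum fun n => ?_
    have hp : 0 ≤ (⟪ket n, T (ket n)⟫_ℂ).re := by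
      have := re_inner_le_of_le hT (ket n)
      simpa using this
    have hl : 0 ≤ -Real.log (thermalProb 1 n) := by
      have := Real.log_nonpos (thermalProb_nonneg zero_le_one n) (thermalProb_le_one zero_le_one n)
      linarith
    rw [← ENNReal.ofReal_mul hl, ← ENNReal.ofReal_add (by positivity)
      (thermalProb_nonneg zero_le_one n)]
    refine ENNReal.ofReal_le_ofReal
      ((re_inner_cfc_negMulLog_le hT n (thermalProb_pos one_pos n)).trans ?_)
    linarith
  refine ne_top_of_le_ne_top ?_ hle
  rw [ENNReal.tsum_add, tsum_neg_log_thermalProb_mul zero_le_one]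
  exact ENNReal.add_ne_top.2 ⟨ENNReal.add_ne_top.2
    ⟨ENNReal.mul_ne_top ENNReal.ofReal_ne_top h1, ENNReal.mul_ne_top ENNReal.ofReal_ne_top h2⟩,
    (summable_thermalProb zero_le_one).tsum_ofReal_ne_top⟩

/-! ### Entropies of mixtures of coherent states -/

theorem isSelfAdjoint_cohMix (μ : Measure ℂ) [IsFiniteMeasure μ] : IsSelfAdjoint (cohMix μ) :=
  IsSelfAdjoint.of_nonneg (cohMix_nonneg μ)

theorem entropy_cohMix_ne_top (μ : Measure ℂ) [IsProbabilityMeasure μ]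
    (h : ∫⁻ u, ENNReal.ofReal (‖u‖ ^ 2) ∂μ ≠ ∞) : entropy (cohMix μ) ≠ ∞ := by
  refine entropy_ne_top (cohMix_nonneg μ) ?_ ?_
  · simp [tsum_inner_ket_cohMix]
  · rwa [tsum_mul_inner_ket_cohMix]

theorem crossEntropy_cohMix {M : ℝ} (hM : 0 ≤ M) (μ : Measure ℂ) [IsProbabilityMeasure μ]
    (h : ∫⁻ u, ENNReal.ofReal (‖u‖ ^ 2) ∂μ = ENNReal.ofReal M) :
    crossEntropy (cohMix μ) (cohMix (thermalLaw M)) =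
      ENNReal.ofReal (Real.log (M + 1)) +
        ENNReal.ofReal (Real.log ((M + 1) / M)) * ENNReal.ofReal M := by
  have h2 := tsum_mul_inner_ket_cohMix μ
  rw [h] at h2
  rw [crossEntropy_of_diagonal (isSelfAdjoint_cohMix _) (thermalProb_nonneg hM)
    (thermalProb_le_one hM) (cohMix_thermalLaw_ket hM), tsum_neg_log_thermalProb_mul hM,
    tsum_inner_ket_cohMix, h2, mul_one]
  intro n hn
  -- Only `M = 0` needs an argument for the support condition: zero mean photon number leaves no
  -- weight on any `n ≥ 1`.
  rcases hM.eq_or_lt with rfl | hM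
  · rw [ENNReal.ofReal_zero, ENNReal.tsum_eq_zero] at h2
    refine (mul_eq_zero.1 (h2 n)).resolve_left ?_
    rcases n with _ | n
    · simp [thermalProb] at hn
    · simp; positivity
  · exact absurd hn (thermalProb_pos hM n).ne'

/-- The value coincides with that in `crossEntropy_cohMix`, because the thermal state has the same
trace and mean photon number as the states considered there. -/
theorem entropy_cohMix_thermalLaw {M : ℝ} (hM : 0 ≤ M) :
    entropy (cohMix (thermalLaw M)) = ENNReal.ofReal (Real.log (M + 1)) +
        ENNReal.ofReal (Real.log ((M + 1) / M)) * ENNReal.ofReal M := by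
  have h2 := lintegral_sq_norm_thermalLaw 0 1 hM
  simp only [Complex.ofReal_one, one_mul, zero_add, norm_zero, one_pow, ne_eq, OfNat.ofNat_ne_zero,
    not_false_eq_true, zero_pow] at h2
  rw [← h2, ← tsum_mul_inner_ket_cohMix, ← mul_one (ENNReal.ofReal (Real.log (M + 1))),
    ← tsum_inner_ket_cohMix (thermalLaw M), ← tsum_neg_log_thermalProb_mul hM,
    entropy_of_diagonal (isSelfAdjoint_cohMix _) (cohMix_thermalLaw_ket hM)]
  refine tsum_congr fun n => ?_
  have hl : 0 ≤ -Real.log (thermalProb M n) := by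
    have := Real.log_nonpos (thermalProb_nonneg hM n) (thermalProb_le_one hM n)
    linarith
  rw [inner_ket_cohMix_thermalLaw hM, if_pos rfl, Complex.ofReal_re, ← ENNReal.ofReal_mul hl,
    Real.negMulLog]
  congr 1
  ring

theorem relEntropy_cohMix {M : ℝ} (hM : 0 ≤ M) (μ : Measure ℂ) [IsProbabilityMeasure μ]
    (h : ∫⁻ u, ENNReal.ofReal (‖u‖ ^ 2) ∂μ = ENNReal.ofReal M) :
    relEntropy (cohMix μ) (cohMix (thermalLaw M)) =
      (((entropy (cohMix (thermalLaw M))).toReal - (entropy (cohMix μ)).toReal : ℝ) : EReal) := by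
  have h1 : entropy (cohMix μ) ≠ ∞ := entropy_cohMix_ne_top μ (h ▸ ENNReal.ofReal_ne_top)
  have h2 : crossEntropy (cohMix μ) (cohMix (thermalLaw M)) = entropy (cohMix (thermalLaw M)) := by
    rw [crossEntropy_cohMix hM μ h, entropy_cohMix_thermalLaw hM]
  have h3 : entropy (cohMix (thermalLaw M)) ≠ ∞ := by
    rw [entropy_cohMix_thermalLaw hM]
    exact ENNReal.add_ne_top.2 ⟨ENNReal.ofReal_ne_top,
      ENNReal.mul_ne_top ENNReal.ofReal_ne_top ENNReal.ofReal_ne_top⟩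
  rw [relEntropy, h2, EReal.coe_sub, EReal.coe_ennreal_toReal h1, EReal.coe_ennreal_toReal h3]

/-! ### Isometric invariance of the entropy -/

-- Both sides are the sum of the squared moduli of all matrix elements, the squared Hilbert–Schmidt
-- norm.
open ContinuousLinearMap in
theorem tsum_sq_norm_adjoint (A : Op ℕ) :
    ∑' n, ENNReal.ofReal (‖A (ket n)‖ ^ 2) = ∑' n, ENNReal.ofReal (‖adjoint A (ket n)‖ ^ 2) := by
  simp_rw [← tsum_ofReal_sq_norm_inner_ket]
  rw [ENNReal.tsum_comm]
  refine tsum_congr fun m => tsum_congr fun n => ?_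
  rw [adjoint_inner_right, ← norm_inner_symm]

-- With `S = R†R`, both traces are squared Hilbert–Schmidt norms, of `R V†` and of `R`. Passing to
-- adjoints puts `V` on the left, where it preserves norms, so `V` need not be surjective.
open ContinuousLinearMap in
theorem posTrace_conj_isometry {V : Op ℕ} (hV : ∀ x, ‖V x‖ = ‖x‖) {S : Op ℕ} (hS : 0 ≤ S) :
    posTrace (V * S * adjoint V) = posTrace S := by
  obtain ⟨R, rfl⟩ := CStarAlgebra.nonneg_iff_eq_star_mul_self.1 hS
  have h : ∀ A : Op ℕ, posTrace (star A * A) = ∑' n, ENNReal.ofReal (‖A (ket n)‖ ^ 2) := by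
    intro A
    refine tsum_congr fun n => ?_
    rw [mul_apply_eq_comp, star_eq_adjoint, adjoint_inner_right, inner_self_eq_norm_sq_to_K]
    norm_cast
  have h1 : V * (star R * R) * adjoint V = star (R * star V) * (R * star V) := by
    rw [← star_eq_adjoint]
    simp only [star_mul, star_star, mul_assoc]
  rw [h1, h, h, tsum_sq_norm_adjoint, tsum_sq_norm_adjoint R]
  refine tsum_congr fun n => ?_
  rw [← star_eq_adjoint, star_mul, star_star, mul_apply_eq_comp, hV, star_eq_adjoint]

/-- Conjugation `T ↦ V T V†` by an isometry. -/
noncomputable def conjIsometry (V : Op ℕ) (hV : star V * V = 1) : Op ℕ →⋆ₙₐ[ℝ] Op ℕ where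
  toFun T := V * T * star V
  map_smul' c T := by simp
  map_zero' := by simp
  map_add' S T := by simp [mul_add, add_mul]
  map_mul' S T := by
    calc V * (S * T) * star V = V * S * 1 * T * star V := by simp only [mul_one, mul_assoc]
      _ = V * S * star V * (V * T * star V) := by rw [← hV]; simp only [mul_assoc]
  map_star' T := by simp [mul_assoc]

/-- Conjugation by an isometry that may fail to be onto is only a non-unital homomorphism, hence the
condition `f 0 = 0`; `-x log x` satisfies it. -/
theorem cfc_conj_isometry {V : Op ℕ} (hV : star V * V = 1) {T : Op ℕ} (hT : IsSelfAdjoint T)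
    {f : ℝ → ℝ} (hf : Continuous f) (h0 : f 0 = 0) :
    cfc f (V * T * star V) = V * cfc f T * star V := by
  have hs : IsSelfAdjoint (V * T * star V) := hT.conjugate V
  have h := NonUnitalStarAlgHom.map_cfcₙ (conjIsometry V hV) f T hf.continuousOn h0
    (by change Continuous fun T : Op ℕ => V * T * star V
        fun_prop) hT hs
  rw [cfcₙ_eq_cfc hf.continuousOn h0] at h
  change V * cfc f T * star V = cfcₙ f (V * T * star V) at h
  rw [h, cfcₙ_eq_cfc hf.continuousOn h0]

theorem entropy_conj_isometry {V : Op ℕ} (hV : ∀ x, ‖V x‖ = ‖x‖) {T : Op ℕ} (hT : 0 ≤ T)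
    (h1 : ‖T‖ ≤ 1) : entropy (V ∘L T ∘L ContinuousLinearMap.adjoint V) = entropy T := by
  have hV' : star V * V = 1 := by
    rw [ContinuousLinearMap.star_eq_adjoint]
    exact (ContinuousLinearMap.norm_map_iff_adjoint_comp_self V).1 hV
  -- `posTrace` discards negative parts; the norm bound keeps the spectrum in `[0, 1]`, where `-x
  -- log x` is nonnegative.
  have hpos : 0 ≤ cfc Real.negMulLog T := by
    refine cfc_nonneg fun x hx => ?_
    have hx0 := spectrum_nonneg_of_nonneg hT hx
    have hx1 : ‖x‖ ≤ 1 := (spectrum.norm_le_norm_mul_of_mem hx).trans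
      (mul_le_one₀ h1 (norm_nonneg _) ContinuousLinearMap.norm_id_le)
    exact Real.negMulLog_nonneg hx0 ((le_abs_self x).trans hx1)
  rw [entropy, entropy, ← posTrace_conj_isometry hV hpos, ← ContinuousLinearMap.star_eq_adjoint,
    ← cfc_conj_isometry hV' (IsSelfAdjoint.of_nonneg hT) Real.continuous_negMulLog
      Real.negMulLog_zero]
  rfl

/-! ### Displacements -/

/-- The phase in `D(β)|w⟩ = exp((β w̄ - β̄ w)/2) |w + β⟩`. -/
noncomputable def displacePhase (β w : ℂ) : ℂ :=
  Complex.exp ((β * (starRingEnd ℂ) w - (starRingEnd ℂ) β * w) / 2)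

theorem inner_displaced (β z w : ℂ) :
    ⟪displacePhase β z • coherent (z + β), displacePhase β w • coherent (w + β)⟫_ℂ =
      ⟪coherent z, coherent w⟫_ℂ := by
  have h : ∀ x : ℂ, ((‖x‖ ^ 2 : ℝ) : ℂ) = (starRingEnd ℂ) x * x := fun x => by
    rw [← Complex.normSq_eq_conj_mul_self, Complex.normSq_eq_norm_sq]
  rw [inner_smul_left, inner_smul_right, inner_coherent, inner_coherent, displacePhase,
    displacePhase, ← Complex.exp_conj, ← Complex.exp_add, ← Complex.exp_add]
  simp only [h, map_div₀, map_sub, map_mul, map_add, Complex.conj_conj, map_ofNat]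
  congr 1
  ring

theorem norm_displacePhase (β w : ℂ) : ‖displacePhase β w‖ = 1 := by
  rw [displacePhase, Complex.norm_exp]
  simp

/-- Finite superpositions of coherent states. -/
noncomputable def coherentSum : (ℂ →₀ ℂ) →ₗ[ℂ] Fock ℕ := Finsupp.linearCombination ℂ coherent

/-- Finite superpositions of displaced coherent states. -/
noncomputable def displacedSum (β : ℂ) : (ℂ →₀ ℂ) →ₗ[ℂ] Fock ℕ :=
  Finsupp.linearCombination ℂ fun w => displacePhase β w • coherent (w + β)

/-- With their phases, the displaced coherent states have the same Gram matrix as the original ones.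
Hence displacement is well defined on their span, with no appeal to linear independence, and extends
isometrically by density. -/
theorem norm_displacedSum (β : ℂ) (f : ℂ →₀ ℂ) : ‖displacedSum β f‖ = ‖coherentSum f‖ := by
  have h : ⟪displacedSum β f, displacedSum β f⟫_ℂ = ⟪coherentSum f, coherentSum f⟫_ℂ := by
    rw [displacedSum, coherentSum, Finsupp.linearCombination_apply,
      Finsupp.linearCombination_apply]
    simp only [Finsupp.sum, sum_inner, inner_sum]
    refine Finset.sum_congr rfl fun z _ => Finset.sum_congr rfl fun w _ => ?_
    rw [inner_smul_left, inner_smul_right, inner_displaced, inner_smul_left, inner_smul_right]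
  rw [@norm_eq_sqrt_re_inner ℂ, h, ← @norm_eq_sqrt_re_inner ℂ]

theorem denseRange_coherentSum : DenseRange coherentSum := by
  have h : (LinearMap.range coherentSum).topologicalClosure = ⊤ := by
    rw [Submodule.topologicalClosure_eq_top_iff, Submodule.eq_bot_iff]
    intro v hv
    refine eq_zero_of_inner_coherent fun z => ?_
    refine (Submodule.mem_orthogonal _ v).1 hv _ ⟨Finsupp.single z 1, ?_⟩
    simp [coherentSum]
  rw [← Submodule.dense_iff_topologicalClosure_eq_top] at h
  rwa [LinearMap.coe_range] at h

/-- The displacement `D(β)`. -/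
noncomputable def displace (β : ℂ) : Op ℕ := (displacedSum β).extendOfNorm coherentSum

theorem displace_coherentSum (β : ℂ) (f : ℂ →₀ ℂ) :
    displace β (coherentSum f) = displacedSum β f :=
  LinearMap.extendOfNorm_eq denseRange_coherentSum
    ⟨1, fun x => by rw [one_mul, norm_displacedSum]⟩ f

theorem displace_coherent (β w : ℂ) :
    displace β (coherent w) = displacePhase β w • coherent (w + β) := by
  have h := displace_coherentSum β (Finsupp.single w 1)
  simpa [coherentSum, displacedSum] using h

theorem norm_displace (β : ℂ) (v : Fock ℕ) : ‖displace β v‖ = ‖v‖ := by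
  refine denseRange_coherentSum.induction_on (p := fun v => ‖displace β v‖ = ‖v‖) v ?_ fun f => ?_
  · exact isClosed_eq (displace β).continuous.norm continuous_norm
  · rw [displace_coherentSum, norm_displacedSum]

theorem integral_conj_op {ι κ : Type} {μ : Measure ℂ} {f : ℂ → Op ι} (hf : Integrable f μ)
    (A : Fock ι →L[ℂ] Fock κ) :
    ∫ z, A ∘L f z ∘L ContinuousLinearMap.adjoint A ∂μ =
      A ∘L (∫ z, f z ∂μ) ∘L ContinuousLinearMap.adjoint A :=
  ((ContinuousLinearMap.compL ℂ (Fock κ) (Fock ι) (Fock κ) A) ∘L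
    ((ContinuousLinearMap.compL ℂ (Fock κ) (Fock ι) (Fock ι)).flip
      (ContinuousLinearMap.adjoint A))).integral_comp_comm hf

theorem displace_cohMix (β : ℂ) (μ : Measure ℂ) [IsFiniteMeasure μ] :
    displace β ∘L cohMix μ ∘L ContinuousLinearMap.adjoint (displace β) =
      cohMix (μ.map fun w => w + β) := by
  have hc : Continuous fun w : ℂ => proj (coherent w) := continuous_proj_coherent
  rw [cohMix, cohMix, ← integral_conj_op (integrable_proj_coherent μ),
    integral_map (by fun_prop) hc.aestronglyMeasurable]
  refine integral_congr_ae (ae_of_all _ fun w => ?_)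
  simp only [comp_proj_comp_adjoint, displace_coherent, proj_smul, norm_displacePhase]
  simp

theorem norm_cohMix_le (μ : Measure ℂ) [IsProbabilityMeasure μ] : ‖cohMix μ‖ ≤ 1 := by
  refine (norm_integral_le_of_norm_le_const (ae_of_all _ fun u => (norm_proj_coherent u).le)).trans ?_
  simp

theorem entropy_cohMix_translate (β : ℂ) (μ : Measure ℂ) [IsProbabilityMeasure μ] :
    entropy (cohMix (μ.map fun w => w + β)) = entropy (cohMix μ) := by
  rw [← displace_cohMix]
  exact entropy_conj_isometry (norm_displace β) (cohMix_nonneg μ) (norm_cohMix_le μ)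

/-! ### The beamsplitter on coherent states -/

theorem commute_createA_createB : Commute createA createB := by
  refine LinearMap.ext fun f => ?_
  refine ext_single (A := createA * createB) (B := createB * createA) (fun m n => ?_) f
  simp only [Module.End.mul_apply, createA_single, createB_single]
  rw [single_eq_smul (m, n + 1), single_eq_smul (m + 1, n), map_smul, map_smul, createA_single,
    createB_single]
  simp [mul_comm]

theorem commute_splitA_splitB (k : ℝ) : Commute (splitA k) (splitB k) := by
  refine LinearMap.ext fun f => ?_
  have h : createA (createB f) = createB (createA f) :=
    LinearMap.congr_fun commute_createA_createB.eq f
  simp only [splitA, splitB, Module.End.mul_apply, LinearMap.sub_apply, LinearMap.add_apply,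
    LinearMap.smul_apply, map_add, map_sub, map_smul, h]
  module

/-- The exponential series `∑ zᵐ wⁿ Aᵐ Bⁿ / (m! n!)` in degree `d`. -/
theorem sum_antidiagonal_smul_pow {A B : FinVec →ₗ[ℂ] FinVec} (h : Commute A B) (z w : ℂ) (d : ℕ) :
    ∑ p ∈ Finset.HasAntidiagonal.antidiagonal d, (z ^ p.1 * w ^ p.2 / (p.1.factorial * p.2.factorial)) •
      (A ^ p.1 * B ^ p.2) = (d.factorial : ℂ)⁻¹ • (z • A + w • B) ^ d := by
  rw [((h.smul_left z).smul_right w).add_pow', Finset.smul_sum]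
  refine Finset.sum_congr rfl fun p hp => ?_
  obtain rfl := Finset.HasAntidiagonal.mem_antidiagonal.1 hp
  rw [smul_pow, smul_pow, smul_mul_smul_comm, ← Nat.cast_smul_eq_nsmul ℂ, smul_smul, smul_smul]
  congr 1
  have h1 : (((p.1 + p.2).choose p.1 : ℕ) : ℂ) * (p.1.factorial * p.2.factorial) =
      (p.1 + p.2).factorial := by
    rw [← mul_assoc]
    rw [Nat.choose_symm_add]
    exact_mod_cast Nat.add_choose_mul_factorial_mul_factorial p.1 p.2
  have h2 : ((p.1 + p.2).factorial : ℂ) ≠ 0 := by exact_mod_cast Nat.factorial_ne_zero _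
  have h3 : ((p.1.factorial : ℂ) * p.2.factorial) ≠ 0 := by
    exact_mod_cast mul_ne_zero (Nat.factorial_ne_zero _) (Nat.factorial_ne_zero _)
  have h4 : (((p.1 + p.2).choose p.1 : ℕ) : ℂ) ≠ 0 := left_ne_zero_of_mul (h1 ▸ h2)
  rw [← h1]
  field_simp

theorem createB_pow_vacuum (n : ℕ) : (createB ^ n) (Finsupp.single (0, 0) 1) =
    Finsupp.single (0, n) (Real.sqrt n.factorial : ℂ) := by
  induction n with
  | zero => simp
  | succ n ih =>
    rw [pow_succ', Module.End.mul_apply, ih, single_eq_smul, map_smul, createB_single,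
      Finsupp.smul_single, smul_eq_mul, ← Complex.ofReal_mul, ← Real.sqrt_mul (by positivity),
      Nat.factorial_succ]
    push_cast
    rw [mul_comm]

theorem createA_pow_ket (m n : ℕ) : (createA ^ m) (Finsupp.single (0, n) 1) =
    Finsupp.single (m, n) (Real.sqrt m.factorial : ℂ) := by
  induction m with
  | zero => simp
  | succ m ih =>
    rw [pow_succ', Module.End.mul_apply, ih, single_eq_smul, map_smul, createA_single,
      Finsupp.smul_single, smul_eq_mul, ← Complex.ofReal_mul, ← Real.sqrt_mul (by positivity),
      Nat.factorial_succ]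
    push_cast
    rw [mul_comm]

/-- Regrouping by creation operators is what turns the rotation of operators into a rotation of
amplitudes. -/
theorem smul_split_add (k : ℝ) (z w : ℂ) : z • splitA k + w • splitB k =
    (k * z + lossAmp k * w) • createA + (k * w - lossAmp k * z) • createB := by
  unfold splitA splitB
  module

theorem sum_antidiagonal_smul_splitVec (k : ℝ) (z w : ℂ) (d : ℕ) :
    ∑ p ∈ Finset.HasAntidiagonal.antidiagonal d, (z ^ p.1 * w ^ p.2 / (p.1.factorial * p.2.factorial)) •
      splitVec k p.1 p.2 =
    ∑ p ∈ Finset.HasAntidiagonal.antidiagonal d, ((k * z + lossAmp k * w) ^ p.1 * (k * w - lossAmp k * z) ^ p.2 /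
      (p.1.factorial * p.2.factorial)) •
        Finsupp.single p ((Real.sqrt p.1.factorial : ℂ) * (Real.sqrt p.2.factorial : ℂ)) := by
  have h := (sum_antidiagonal_smul_pow (commute_splitA_splitB k) z w d).trans
    ((congrArg (fun T => (d.factorial : ℂ)⁻¹ • T ^ d) (smul_split_add k z w)).trans
      (sum_antidiagonal_smul_pow commute_createA_createB _ _ d).symm)
  have h' := congrArg (fun T : FinVec →ₗ[ℂ] FinVec => T (Finsupp.single (0, 0) 1)) h
  simp only [LinearMap.sum_apply, LinearMap.smul_apply, Module.End.mul_apply,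
    createB_pow_vacuum] at h'
  refine h'.trans (Finset.sum_congr rfl fun p _ => ?_)
  rw [single_eq_smul (0, p.2), map_smul, createA_pow_ket]
  congr 1
  rw [Finsupp.smul_single, smul_eq_mul, mul_comm]

theorem hasSum_antidiagonal {E : Type*} [NormedAddCommGroup E] {f : ℕ × ℕ → E} {a : E}
    (h : HasSum f a) : HasSum (fun d => ∑ p ∈ Finset.HasAntidiagonal.antidiagonal d, f p) a := by
  have h1 := (Finset.HasAntidiagonal.sigmaAntidiagonalEquivProd (A := ℕ)).hasSum_iff.2 h
  refine h1.sigma fun d => ?_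
  exact (Finset.HasAntidiagonal.antidiagonal d).hasSum f

theorem inner_ket_tensorVec_coherent (z w : ℂ) (p : ℕ × ℕ) :
    ⟪ket p, tensorVec (coherent z) (coherent w)⟫_ℂ =
      (Real.exp (-(‖z‖ ^ 2 + ‖w‖ ^ 2) / 2) : ℂ) * ((z ^ p.1 * w ^ p.2) /
        ((Real.sqrt p.1.factorial : ℂ) * (Real.sqrt p.2.factorial : ℂ))) := by
  have h : Real.exp (-(‖z‖ ^ 2 + ‖w‖ ^ 2) / 2) =
      Real.exp (-‖z‖ ^ 2 / 2) * Real.exp (-‖w‖ ^ 2 / 2) := by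
    rw [← Real.exp_add]; congr 1; ring
  rw [inner_ket_tensorVec, inner_ket_coherent, inner_ket_coherent, h, Complex.ofReal_mul]
  ring

theorem norm_sq_add_norm_sq_split {k : ℝ} (h0 : 0 ≤ k) (h1 : k ≤ 1) (z w : ℂ) :
    ‖k * z + lossAmp k * w‖ ^ 2 + ‖k * w - lossAmp k * z‖ ^ 2 = ‖z‖ ^ 2 + ‖w‖ ^ 2 := by
  have h : lossAmp k ^ 2 = 1 - k ^ 2 := Real.sq_sqrt (by nlinarith)
  simp only [← Complex.normSq_eq_norm_sq, Complex.normSq_apply]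
  simp
  linear_combination (z.re ^ 2 + z.im ^ 2 + w.re ^ 2 + w.im ^ 2) * h

theorem beamsplitter_ket (k : Set.Icc (0 : ℝ) 1) (p : ℕ × ℕ) :
    beamsplitter k (ket p) = splitKet k p :=
  isometryOf_ket _ p

/-- Up to normalization, a product of coherent states is the exponential of `z a† + w b†` applied to
the vacuum. The expansions are compared in each total photon number `d`, where they are finite sums,
and the normalizations agree because the rotation preserves `|z|² + |w|²`. -/
theorem beamsplitter_coherent (k : Set.Icc (0 : ℝ) 1) (z w : ℂ) :
    beamsplitter k (tensorVec (coherent z) (coherent w)) =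
      tensorVec (coherent ((k : ℝ) * z + lossAmp k * w))
        (coherent ((k : ℝ) * w - lossAmp k * z)) := by
  have h1 := hasSum_antidiagonal
    ((hasSum_ket (tensorVec (coherent z) (coherent w))).mapL (beamsplitter k))
  have h2 := hasSum_antidiagonal (hasSum_ket (tensorVec
    (coherent ((k : ℝ) * z + lossAmp k * w)) (coherent ((k : ℝ) * w - lossAmp k * z))))
  refine h1.unique (h2.congr_fun fun d => ?_)
  have h3 := congrArg (fun f => (Real.exp (-(‖z‖ ^ 2 + ‖w‖ ^ 2) / 2) : ℂ) • toFock f)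
    (sum_antidiagonal_smul_splitVec (k : ℝ) z w d)
  simp only [map_sum, map_smul, Finset.smul_sum, smul_smul, toFock_single] at h3
  refine Eq.trans ?_ (h3.trans ?_)
  · refine Finset.sum_congr rfl fun p _ => ?_
    rw [map_smul, beamsplitter_ket, splitKet, inner_ket_tensorVec_coherent, smul_smul,
      Real.sqrt_mul (by positivity), Complex.ofReal_mul, ← sqrt_factorial_mul_self p.1,
      ← sqrt_factorial_mul_self p.2]
    congr 1
    have ha := sqrt_factorial_ne_zero p.1
    have hb := sqrt_factorial_ne_zero p.2
    field_simp
  · refine Finset.sum_congr rfl fun p _ => ?_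
    rw [inner_ket_tensorVec_coherent, norm_sq_add_norm_sq_split k.2.1 k.2.2,
      ← sqrt_factorial_mul_self p.1, ← sqrt_factorial_mul_self p.2]
    congr 1
    have ha := sqrt_factorial_ne_zero p.1
    have hb := sqrt_factorial_ne_zero p.2
    field_simp

/-! ### The channel outputs as mixtures of coherent states -/

theorem continuous_proj_tensorVec_coherent (v : Fock ℕ) :
    Continuous fun w => proj (tensorVec v (coherent w)) :=
  continuous_proj.comp ((continuous_tensorVec v).comp continuous_coherent)

theorem integrable_proj_tensorVec_coherent (v : Fock ℕ) (μ : Measure ℂ) [IsFiniteMeasure μ] :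
    Integrable (fun w => proj (tensorVec v (coherent w))) μ :=
  integrable_of_continuous_of_norm_le (continuous_proj_tensorVec_coherent v) (‖v‖ ^ 2) fun w => by
    rw [norm_proj, norm_tensorVec, norm_coherent, mul_one]

theorem summable_tensorThermal {N : ℝ} (hN : 0 ≤ N) (v : Fock ℕ) :
    Summable fun n : ℕ => (thermalProb N n : ℂ) •
      (tensorKetRight n ∘L proj v ∘L ContinuousLinearMap.adjoint (tensorKetRight n)) := by
  refine Summable.of_norm_bounded ((summable_thermalProb hN).mul_right (‖v‖ ^ 2)) fun n => ?_
  rw [comp_proj_comp_adjoint, norm_smul, norm_proj, tensorKetRight, isometryOf_norm,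
    Complex.norm_real, Real.norm_of_nonneg (thermalProb_nonneg hN n)]

theorem tensorThermal_proj {N : ℝ} (hN : 0 ≤ N) (v : Fock ℕ) :
    tensorThermal N (proj v) = ∫ w, proj (tensorVec v (coherent w)) ∂(thermalLaw N) := by
  refine op_ext_ket fun p q => ?_
  rw [inner_integral_op (integrable_proj_tensorVec_coherent v _)]
  have h := (summable_tensorThermal hN v).hasSum.mapL (matElem (ket p) (ket q))
  -- Each matrix element of the series has at most one nonzero term, so the sum over `n` is
  -- explicit.
  have h2 : ∀ n, matElem (ket p) (ket q) ((thermalProb N n : ℂ) •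
      (tensorKetRight n ∘L proj v ∘L ContinuousLinearMap.adjoint (tensorKetRight n))) =
      if n = p.2 then (if p.2 = q.2 then (thermalProb N p.2 : ℂ) *
        (⟪ket p.1, v⟫_ℂ * (starRingEnd ℂ) ⟪ket q.1, v⟫_ℂ) else 0) else 0 := by
    intro n
    rw [map_smul, matElem_apply, ContinuousLinearMap.comp_apply, ContinuousLinearMap.comp_apply,
      ← ContinuousLinearMap.adjoint_inner_left, adjoint_tensorKetRight_ket,
      adjoint_tensorKetRight_ket]
    by_cases h1 : n = p.2
    · subst h1
      by_cases h3 : p.2 = q.2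
      · rw [if_pos rfl, if_pos h3.symm, if_pos rfl, if_pos h3, inner_ket_proj, smul_eq_mul]
      · rw [if_neg (Ne.symm h3), if_neg h3]
        simp
    · rw [if_neg (Ne.symm h1), if_neg h1]
      simp
  simp_rw [h2] at h
  have h4 : ⟪ket p, tensorThermal N (proj v) (ket q)⟫_ℂ = if p.2 = q.2 then
      (thermalProb N p.2 : ℂ) * (⟪ket p.1, v⟫_ℂ * (starRingEnd ℂ) ⟪ket q.1, v⟫_ℂ) else 0 :=
    h.unique (hasSum_ite_eq p.2 _)
  have h5 : ∀ w, ⟪ket p, proj (tensorVec v (coherent w)) (ket q)⟫_ℂ =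
      (⟪ket p.1, v⟫_ℂ * (starRingEnd ℂ) ⟪ket q.1, v⟫_ℂ) *
        (⟪ket p.2, coherent w⟫_ℂ * ⟪coherent w, ket q.2⟫_ℂ) := by
    intro w
    rw [inner_ket_proj, inner_ket_tensorVec, inner_ket_tensorVec, map_mul,
      inner_conj_symm (coherent w)]
    ring
  simp_rw [h5]
  rw [h4, integral_const_mul, ← inner_cohMix, inner_ket_cohMix_thermalLaw hN]
  split_ifs
  · ring
  · ring

theorem jointOutput_coherent (k : Set.Icc (0 : ℝ) 1) {N : ℝ} (hN : 0 ≤ N) (z : ℂ) :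
    jointOutput k N (proj (coherent z)) =
      ∫ w, proj (tensorVec (coherent ((k : ℝ) * z + lossAmp k * w))
        (coherent ((k : ℝ) * w - lossAmp k * z))) ∂(thermalLaw N) := by
  rw [jointOutput, tensorThermal_proj hN,
    ← integral_conj_op (integrable_proj_tensorVec_coherent _ _)]
  simp only [comp_proj_comp_adjoint, beamsplitter_coherent]

theorem adjoint_comp_proj_comp {ι κ : Type} (A : Fock ι →L[ℂ] Fock κ) (v : Fock κ) :
    ContinuousLinearMap.adjoint A ∘L proj v ∘L A = proj (ContinuousLinearMap.adjoint A v) := by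
  have h := comp_proj_comp_adjoint (ContinuousLinearMap.adjoint A) v
  rwa [ContinuousLinearMap.adjoint_adjoint] at h

theorem integral_adjoint_conj_op {ι κ : Type} {μ : Measure ℂ} {f : ℂ → Op κ} (hf : Integrable f μ)
    (A : Fock ι →L[ℂ] Fock κ) :
    ContinuousLinearMap.adjoint A ∘L (∫ z, f z ∂μ) ∘L A =
      ∫ z, ContinuousLinearMap.adjoint A ∘L f z ∘L A ∂μ := by
  have h := integral_conj_op hf (ContinuousLinearMap.adjoint A)
  rw [ContinuousLinearMap.adjoint_adjoint] at h
  exact h.symm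

/-- This is the partial trace under the integral: by Parseval the weights of the discarded unit
vector `b w` sum to `1`, and they serve as their own dominating functions. -/
theorem hasSum_integral_sq_norm_smul {μ : Measure ℂ} [IsProbabilityMeasure μ] {f : ℂ → Op ℕ}
    (hf : Continuous f) (hf1 : ∀ w, ‖f w‖ = 1) {b : ℂ → Fock ℕ} (hb : Continuous b)
    (hb1 : ∀ w, ‖b w‖ = 1) :
    HasSum (fun n : ℕ => ∫ w, ((‖⟪ket n, b w⟫_ℂ‖ ^ 2 : ℝ) : ℂ) • f w ∂μ) (∫ w, f w ∂μ) := by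
  have hs : ∀ w, HasSum (fun n : ℕ => ‖⟪ket n, b w⟫_ℂ‖ ^ 2) 1 := fun w => by
    have h := hasSum_sq_norm_inner_ket (b w)
    rwa [hb1, one_pow] at h
  refine hasSum_integral_of_dominated_convergence (fun n w => ‖⟪ket n, b w⟫_ℂ‖ ^ 2)
    (fun n => ?_) (fun n => ae_of_all _ fun w => ?_) (ae_of_all _ fun w => (hs w).summable) ?_
    (ae_of_all _ fun w => ?_)
  · exact ((Complex.continuous_ofReal.comp
      ((continuous_const.inner hb).norm.pow 2)).smul hf).aestronglyMeasurable
  · rw [norm_smul, hf1, mul_one, Complex.norm_real, Real.norm_of_nonneg (by positivity)]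
  · simp only [(hs _).tsum_eq]
    exact integrable_const _
  · have h := ((hs w).mapL Complex.ofRealCLM).smul_const (f w)
    simpa using h

theorem traceAncilla_integral {μ : Measure ℂ} [IsProbabilityMeasure μ] {a b : ℂ → Fock ℕ}
    (ha : Continuous a) (ha1 : ∀ w, ‖a w‖ = 1) (hb : Continuous b) (hb1 : ∀ w, ‖b w‖ = 1)
    (hab : Integrable (fun w => proj (tensorVec (a w) (b w))) μ) :
    traceAncilla (∫ w, proj (tensorVec (a w) (b w)) ∂μ) = ∫ w, proj (a w) ∂μ := by
  rw [traceAncilla]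
  simp only [integral_adjoint_conj_op hab, adjoint_comp_proj_comp,
    adjoint_tensorKetRight_tensorVec, proj_smul]
  exact (hasSum_integral_sq_norm_smul (continuous_proj.comp ha)
    (fun w => by rw [Function.comp_apply, norm_proj, ha1, one_pow]) hb hb1).tsum_eq

theorem traceSignal_integral {μ : Measure ℂ} [IsProbabilityMeasure μ] {a b : ℂ → Fock ℕ}
    (ha : Continuous a) (ha1 : ∀ w, ‖a w‖ = 1) (hb : Continuous b) (hb1 : ∀ w, ‖b w‖ = 1)
    (hab : Integrable (fun w => proj (tensorVec (a w) (b w))) μ) :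
    traceSignal (∫ w, proj (tensorVec (a w) (b w)) ∂μ) = ∫ w, proj (b w) ∂μ := by
  rw [traceSignal]
  simp only [integral_adjoint_conj_op hab, adjoint_comp_proj_comp,
    adjoint_tensorKetLeft_tensorVec, proj_smul]
  exact (hasSum_integral_sq_norm_smul (continuous_proj.comp hb)
    (fun w => by rw [Function.comp_apply, norm_proj, hb1, one_pow]) ha ha1).tsum_eq

theorem integrable_jointOutput (k : Set.Icc (0 : ℝ) 1) (N : ℝ) (z : ℂ) :
    Integrable (fun w => proj (tensorVec (coherent ((k : ℝ) * z + lossAmp k * w))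
      (coherent ((k : ℝ) * w - lossAmp k * z)))) (thermalLaw N) := by
  simp only [← beamsplitter_coherent]
  refine integrable_of_continuous_of_norm_le ?_ 1 fun w => ?_
  · exact continuous_proj.comp ((beamsplitter k).continuous.comp
      ((continuous_tensorVec _).comp continuous_coherent))
  · rw [beamsplitter, norm_proj, isometryOf_norm, norm_tensorVec, norm_coherent, norm_coherent]
    norm_num

/-- The output for the coherent input `|z⟩` of the channel that scales the amplitude by `α` and adds
to it `γ w`, where `w` is complex Gaussian with `E|w|² = M`. -/
noncomputable def gaussOutput (α γ M : ℝ) (z : ℂ) : Op ℕ :=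
  ∫ w, proj (coherent (α * z + γ * w)) ∂(thermalLaw M)

theorem outputB_eq_gaussOutput (k : Set.Icc (0 : ℝ) 1) {N₀ : ℝ} (hN₀ : 0 ≤ N₀) :
    outputB k N₀ = gaussOutput k (lossAmp k) N₀ := by
  funext z
  rw [outputB, jointOutput_coherent k hN₀, gaussOutput]
  exact traceAncilla_integral (continuous_coherent.comp (by fun_prop)) (fun _ => norm_coherent _)
    (continuous_coherent.comp (by fun_prop)) (fun _ => norm_coherent _)
    (integrable_jointOutput k N₀ z)

theorem outputE_eq_gaussOutput (k : Set.Icc (0 : ℝ) 1) {N₀ : ℝ} (hN₀ : 0 ≤ N₀) :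
    outputE k N₀ = gaussOutput (-lossAmp k) k N₀ := by
  funext z
  rw [outputE, jointOutput_coherent k hN₀, gaussOutput]
  refine (traceSignal_integral (continuous_coherent.comp (by fun_prop)) (fun _ => norm_coherent _)
    (continuous_coherent.comp (by fun_prop)) (fun _ => norm_coherent _)
    (integrable_jointOutput k N₀ z)).trans ?_
  refine integral_congr_ae (ae_of_all _ fun w => ?_)
  simp only [Function.comp_apply, Complex.ofReal_neg]
  ring_nf

theorem outputNoise_eq_gaussOutput {Nc : ℝ} (hNc : 0 < Nc) :
    outputNoise Nc = gaussOutput 1 1 Nc := by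
  funext z
  rw [outputNoise, gaussOutput, gaussLaw_eq_thermalLaw hNc]
  simp

/-! ### Ensembles at the output of a Gaussian channel -/

/-- The input only translates the law of the amplitude, which is what makes the output entropy
independent of `z`. -/
theorem gaussOutput_eq_cohMix (α γ M : ℝ) (z : ℂ) : gaussOutput α γ M z =
    cohMix (((thermalLaw M).map fun w => (γ : ℂ) * w).map fun w => w + α * z) := by
  rw [Measure.map_map (by fun_prop) (by fun_prop), cohMix, gaussOutput, integral_map (by fun_prop)
    continuous_proj_coherent.aestronglyMeasurable]
  simp only [Function.comp_apply, add_comm]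

theorem continuous_gaussOutput (α γ M : ℝ) : Continuous (gaussOutput α γ M) := by
  refine continuous_of_dominated (bound := fun _ => 1) (fun z => ?_)
    (fun z => ae_of_all _ fun w => (norm_proj_coherent _).le) (integrable_const _)
    (ae_of_all _ fun w => continuous_proj_coherent.comp (by fun_prop))
  exact (continuous_proj_coherent.comp (by fun_prop)).aestronglyMeasurable

theorem isProbabilityMeasure_map_mul (γ M : ℝ) :
    IsProbabilityMeasure ((thermalLaw M).map fun w => (γ : ℂ) * w) :=
  Measure.isProbabilityMeasure_map (by fun_prop)

theorem norm_gaussOutput_le (α γ M : ℝ) (z : ℂ) : ‖gaussOutput α γ M z‖ ≤ 1 := by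
  refine (norm_integral_le_of_norm_le_const
    (ae_of_all _ fun u => (norm_proj_coherent _).le)).trans ?_
  simp

theorem entropy_gaussOutput (α γ M : ℝ) (z : ℂ) : entropy (gaussOutput α γ M z) =
    entropy (cohMix ((thermalLaw M).map fun w => (γ : ℂ) * w)) := by
  have := isProbabilityMeasure_map_mul γ M
  rw [gaussOutput_eq_cohMix, entropy_cohMix_translate]

theorem entropy_gaussOutput_ne_top (α γ : ℝ) {M : ℝ} (hM : 0 ≤ M) (z : ℂ) :
    entropy (gaussOutput α γ M z) ≠ ∞ := by
  have := isProbabilityMeasure_map_mul γ M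
  rw [entropy_gaussOutput]
  refine entropy_cohMix_ne_top _ ?_
  rw [lintegral_map (by fun_prop) (by fun_prop)]
  have h := lintegral_sq_norm_thermalLaw 0 γ hM
  simp only [zero_add] at h
  rw [h]
  exact ENNReal.ofReal_ne_top

/-- Fubini merges modulation and noise into a single law of the output amplitude. -/
theorem averageState_gaussOutput (α γ M : ℝ) (μ : Measure ℂ) [IsProbabilityMeasure μ] :
    averageState μ (gaussOutput α γ M) = cohMix (affineLaw α γ μ (thermalLaw M)) := by
  have hc : Continuous fun p : ℂ × ℂ => proj (coherent (α * p.1 + γ * p.2)) :=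
    continuous_proj_coherent.comp (by fun_prop)
  have hi : Integrable (fun p : ℂ × ℂ => proj (coherent (α * p.1 + γ * p.2)))
      (μ.prod (thermalLaw M)) :=
    Integrable.of_bound hc.aestronglyMeasurable 1 (ae_of_all _ fun p => (norm_proj_coherent _).le)
  rw [cohMix, affineLaw, integral_map (measurable_affine α γ).aemeasurable
    continuous_proj_coherent.aestronglyMeasurable, integral_prod _ hi]
  rfl

theorem hasFiniteInfo_gaussOutput (α γ : ℝ) {N M : ℝ} (hN : 0 ≤ N) (hM : 0 ≤ M) (μ : Measure ℂ)
    [IsProbabilityMeasure μ] (hμ : ∫⁻ z, ENNReal.ofReal (‖z‖ ^ 2) ∂μ = ENNReal.ofReal N) :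
    HasFiniteInfo μ (gaussOutput α γ M) := by
  refine ⟨integrable_of_continuous_of_norm_le (continuous_gaussOutput α γ M) 1
    (norm_gaussOutput_le α γ M), ?_, entropy_gaussOutput_ne_top α γ hM, ?_⟩
  · rw [averageState_gaussOutput]
    refine entropy_cohMix_ne_top _ ?_
    rw [lintegral_sq_norm_affineLaw α γ hN hM hμ]
    exact ENNReal.ofReal_ne_top
  · simp only [entropy_gaussOutput]
    exact integrable_const _

theorem mutualInfo_gaussOutput (α γ M : ℝ) (μ : Measure ℂ) [IsProbabilityMeasure μ] :
    mutualInfo μ (gaussOutput α γ M) =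
      (entropy (cohMix (affineLaw α γ μ (thermalLaw M)))).toReal -
        (entropy (cohMix ((thermalLaw M).map fun w => (γ : ℂ) * w))).toReal := by
  rw [mutualInfo, averageState_gaussOutput]
  simp only [entropy_gaussOutput]
  simp

theorem lintegral_sq_norm_gaussLaw {N : ℝ} (hN : 0 < N) :
    ∫⁻ z, ENNReal.ofReal (‖z‖ ^ 2) ∂(gaussLaw N) = ENNReal.ofReal N := by
  have h := lintegral_sq_norm_thermalLaw 0 1 hN.le
  rw [gaussLaw_eq_thermalLaw hN]
  simpa using h

/-- For a Gaussian channel, the loss of mutual information caused by replacing Gaussian modulation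
by a modulation with the same mean energy is the relative entropy of the average outputs. -/
theorem mutualInfo_sub_mutualInfo_gaussOutput (α γ : ℝ) {N M : ℝ} (hN : 0 < N) (hM : 0 ≤ M)
    (μ : Measure ℂ) [IsProbabilityMeasure μ]
    (hμ : ∫⁻ z, ENNReal.ofReal (‖z‖ ^ 2) ∂μ = ENNReal.ofReal N) :
    HasFiniteInfo (gaussLaw N) (gaussOutput α γ M) ∧ HasFiniteInfo μ (gaussOutput α γ M) ∧
      ((mutualInfo (gaussLaw N) (gaussOutput α γ M) - mutualInfo μ (gaussOutput α γ M) : ℝ) :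
        EReal) = relEntropy (averageState μ (gaussOutput α γ M))
          (averageState (gaussLaw N) (gaussOutput α γ M)) := by
  have hg := lintegral_sq_norm_gaussLaw hN
  rw [gaussLaw_eq_thermalLaw hN] at hg ⊢
  refine ⟨hasFiniteInfo_gaussOutput α γ hN.le hM _ hg, hasFiniteInfo_gaussOutput α γ hN.le hM _ hμ,
    ?_⟩
  -- Both mutual informations subtract the same conditional entropy, which cancels in the last
  -- rewrite.
  rw [mutualInfo_gaussOutput, mutualInfo_gaussOutput, averageState_gaussOutput,
    averageState_gaussOutput, affineLaw_thermalLaw α γ hN.le hM,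
    relEntropy_cohMix (by positivity) _ (lintegral_sq_norm_affineLaw α γ hN.le hM hμ),
    sub_sub_sub_cancel_right]

/-! ### Constellations -/

namespace Constellation

variable {m : ℕ} (X : Constellation m)

theorem sum_prob_mul_prob : ∑ i, ∑ j, X.prob i * X.prob j = 1 := by
  simp only [← Finset.mul_sum, X.prob_sum, mul_one]

theorem lintegral_complexLaw (N : ℝ) (f : ℂ → ℝ) (hf0 : ∀ z, 0 ≤ f z) :
    ∫⁻ z, ENNReal.ofReal (f z) ∂(X.complexLaw N) =
      ENNReal.ofReal (∑ i, ∑ j, X.prob i * X.prob j *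
        f ((Real.sqrt (N / 2) : ℂ) * ((X.point i : ℂ) + Complex.I * (X.point j : ℂ)))) := by
  have hp : ∀ i j, 0 ≤ X.prob i * X.prob j := fun i j =>
    mul_nonneg (X.prob_nonneg i) (X.prob_nonneg j)
  rw [complexLaw, ENNReal.ofReal_sum_of_nonneg fun i _ =>
    Finset.sum_nonneg fun j _ => mul_nonneg (hp i j) (hf0 _)]
  simp only [lintegral_finsetSum_measure, lintegral_smul_measure]
  refine Finset.sum_congr rfl fun i _ => ?_
  rw [ENNReal.ofReal_sum_of_nonneg fun j _ => mul_nonneg (hp i j) (hf0 _)]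
  refine Finset.sum_congr rfl fun j _ => ?_
  rw [lintegral_dirac, ENNReal.ofReal_mul (hp i j), smul_eq_mul]

instance (N : ℝ) : IsProbabilityMeasure (X.complexLaw N) := by
  have h := X.lintegral_complexLaw N (fun _ => 1) fun _ => zero_le_one
  refine ⟨?_⟩
  simpa [sum_prob_mul_prob] using h

theorem sum_prob_mul_sq (hmean : X.mean = 0) (hvar : X.variance = 1) :
    ∑ i, X.prob i * X.point i ^ 2 = 1 := by
  simpa [variance, hmean] using hvar

/-- The two quadratures contribute `N/2` each, since mean `0` and variance `1` give `E[X²] = 1`.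
This is the only property of the constellation's moments that the main theorem uses. -/
theorem lintegral_sq_norm_complexLaw {N : ℝ} (hN : 0 ≤ N) (hmean : X.mean = 0)
    (hvar : X.variance = 1) :
    ∫⁻ z, ENNReal.ofReal (‖z‖ ^ 2) ∂(X.complexLaw N) = ENNReal.ofReal N := by
  rw [X.lintegral_complexLaw N (fun z => ‖z‖ ^ 2) fun _ => by positivity]
  congr 1
  have h : ∀ i j, X.prob i * X.prob j *
      ‖(Real.sqrt (N / 2) : ℂ) * ((X.point i : ℂ) + Complex.I * (X.point j : ℂ))‖ ^ 2 =
      N / 2 * ((X.prob i * X.point i ^ 2) * X.prob j + X.prob i * (X.prob j * X.point j ^ 2)) := by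
    intro i j
    rw [norm_mul, mul_pow, Complex.norm_real, Real.norm_eq_abs, sq_abs,
      Real.sq_sqrt (by positivity), ← Complex.normSq_eq_norm_sq, Complex.normSq_apply]
    simp
    ring
  simp only [h, ← Finset.mul_sum, Finset.sum_add_distrib, ← Finset.sum_mul, X.prob_sum,
    X.sum_prob_mul_sq hmean hvar]
  ring

end Constellation

end ThermalChannel

/-! ### The main theorem. -/

theorem mainTheorem3 (N N₀ : ℝ) (hN : 0 < N) (hN₀ : 0 ≤ N₀) (k : Set.Icc (0 : ℝ) 1)
    (m : ℕ) (X : Constellation m) (hmean : X.mean = 0) (hvar : X.variance = 1) :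
    (HasFiniteInfo (gaussLaw N) (outputB k N₀) ∧
      HasFiniteInfo (X.complexLaw N) (outputB k N₀) ∧
      ((mutualInfo (gaussLaw N) (outputB k N₀) -
          mutualInfo (X.complexLaw N) (outputB k N₀) : ℝ) : EReal) =
        relEntropy (averageState (X.complexLaw N) (outputB k N₀))
          (averageState (gaussLaw N) (outputB k N₀))) ∧
    (HasFiniteInfo (gaussLaw N) (outputE k N₀) ∧
      HasFiniteInfo (X.complexLaw N) (outputE k N₀) ∧
      ((mutualInfo (gaussLaw N) (outputE k N₀) -
          mutualInfo (X.complexLaw N) (outputE k N₀) : ℝ) : EReal) =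
        relEntropy (averageState (X.complexLaw N) (outputE k N₀))
          (averageState (gaussLaw N) (outputE k N₀))) ∧
    (∀ Nc : ℝ, 0 < Nc →
      HasFiniteInfo (gaussLaw N) (outputNoise Nc) ∧
      HasFiniteInfo (X.complexLaw N) (outputNoise Nc) ∧
      ((mutualInfo (gaussLaw N) (outputNoise Nc) -
          mutualInfo (X.complexLaw N) (outputNoise Nc) : ℝ) : EReal) =
        relEntropy (averageState (X.complexLaw N) (outputNoise Nc))
          (averageState (gaussLaw N) (outputNoise Nc))) := by
  have hμ := X.lintegral_sq_norm_complexLaw hN.le hmean hvar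
  rw [outputB_eq_gaussOutput k hN₀, outputE_eq_gaussOutput k hN₀]
  refine ⟨mutualInfo_sub_mutualInfo_gaussOutput _ _ hN hN₀ _ hμ,
    mutualInfo_sub_mutualInfo_gaussOutput _ _ hN hN₀ _ hμ, fun Nc hNc => ?_⟩
  rw [outputNoise_eq_gaussOutput hNc]
  exact mutualInfo_sub_mutualInfo_gaussOutput _ _ hN hNc.le _ hμ
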